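/- **Model.** Let $0<\beta<\mu<\theta<1$, $\rho>0$, $\sigma\in(0,1)$. A risky action pays $\omega\in\{0,1\}$ to both players, $\Pr(\omega=1)=\mu$; a safe action pays $\theta$ to the principal and $\beta$ to the agent; payoffs are discounted at rate $\rho$. Real news of type $\omega$ arrives at a random time, independent of $\omega$ and of the agent's type, with differentiable distribution function $G$ on $[0,\infty)$ ($G(0)=0$, $G<1$; real news may never arrive), density $g=G'$ and strictly decreasing hazard rate $H_R=g/(1-G)$. With $\phi_P=\frac{\rho\theta}{\mu(1-\theta)}$ and $\phi_A=\frac{\rho\mu}{\beta(1-\mu)}$, assume $H_R(0)>\phi_P>\lim_{t\to\infty}H_R(t)$ and $\phi_P>\phi_A$. Let $\tau_P$ be the principal's optimal first-best search duration, i.e. the unique maximizer over $t\in[0,\infty]$ of $\int_0^te^{-\rho x}g(x)(\mu+(1-\mu)\theta)\,dx+e^{-\rho t}(1-G(t))\theta$ (the last term being $0$ at $t=\infty$). With probability $\sigma$ the agent can fake type-1 news (never type-0 news), at a time drawn from a mixed strategy $F_A$ on $[0,\infty]$; the principal stops and takes the safe action at a time drawn from $F_P$ on $[0,\infty]$ if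 no news has arrived, takes the safe action after type-0 news, and takes the risky action after type-1 news at $t$ with probability $a(t)$. $F_A,F_P$ consist of an absolutely continuous part, whose density is its right derivative wherever that exists, and countably many atoms; $f_A,f_P$ denote density plus atoms (Dirac masses). The posterior probability of $\omega=1$ after type-1 news at $t$ is, by Bayes' rule, $$\mu_1(t)=\frac{\mu g(t)(1-\sigma F_A(t))+\mu\sigma f_A(t)(1-G(t))}{\mu g(t)(1-\sigma F_A(t))+\sigma f_A(t)(1-G(t))},$$ read as $\mu$ at an atom of $F_A$. Write $w_0=(1-\mu)g(1-\sigma F_A)$ and let $w_1$ be the denominator above. The payoffs of stopping, respectively faking, at $t\in[0,\infty]$ are $$u_P(t)=\int_0^te^{-\rho s}\{w_0(s)\theta+w_1(s)((1-a(s))\theta+a(s)\mu_1(s))\}ds+e^{-\rho t}(1-G(t))(1-\sigma F_A(t))\theta,$$ $$u_A(t)=\int_0^te^{-\rho s}\{g(s)(1-F_P(s))[(1-\mu)\beta+\mu((1-a(s))\beta+a(s))]+f_P(s)(1-G(s))\beta\}ds+e^{-\rho t}(1-G(t))(1-F_P(t))((1-a(t))\beta+\mu a(t)),$$ where integrals include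 atoms in $[0,t]$ and the last terms are $0$ at $t=\infty$. A profile $(a,F_P,F_A)$ is an equilibrium if, for $i\in\{A,P\}$, every $t\in[0,\infty]$ with $f_i(t)>0$ (positive density or an atom) maximizes $u_i$ over $[0,\infty]$, and, for every $t\ge0$, $a(t)=1$ if $\mu_1(t)>\theta$ and $a(t)=0$ if $\mu_1(t)<\theta$. It has beneficial search if the principal's expected payoff exceeds $\theta$. **Corollary (Beneficial Search, Beliefs).** In every equilibrium with beneficial search, $F_A$ and $F_P$ are both supported exactly on $[\tau_M,\tau_P]$ for some $0<\tau_M<\tau_P$, and: (i) $\mu_1(t)=1$ for $t\in[0,\tau_M)$ and for $t\ge\tau_P$, and for $t\in[\tau_M,\tau_P]$ $$\mu_1(t)=\theta+(\theta-\mu)\frac{\rho\theta}{H_R(t)\mu(1-\mu)-\rho\theta},$$ where the denominator is positive (at $\tau_P$ both expressions equal $1$). (ii) $\mu_1$ has a downward jump at $\tau_M$ (its left limit there is $1$, while it is right-continuous there with $\mu_1(\tau_M)<1$), is strictly increasing on $[\tau_M,\tau_P)$ and is continuous at $\tau_P$. Moreover there is $\epsilon>0$ such that $\mu_1(t)\ge\theta+\epsilon$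 for all $t\ge0$. (iii) Type-0 news reveals $\omega=0$ at all times: at every $t\ge0$ it has positive density, and the posterior probability of $\omega=1$ after it is $0$. -/

import Mathlib

open Set Filter Topology MeasureTheory

noncomputable section

/-- Primitives of the search game: the players' safe payoffs `θ` (principal) and `β` (agent), the
prior `μ` that the risky payoff `ω` equals `1`, the discount rate `ρ`, the prior probability `σ`
that the agent is able to fake, and the distribution function `G` of the arrival time of real news
on `[0, ∞)`, with density `g`. Real news may fail to arrive: `G` need not tend to `1`. -/
structure SearchGame where
  θ : ℝ
  β : ℝ
  μ : ℝ
  ρ : ℝ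
  σ : ℝ
  G : ℝ → ℝ
  g : ℝ → ℝ
  β_pos : 0 < β
  β_lt_μ : β < μ
  μ_lt_θ : μ < θ
  θ_lt_one : θ < 1
  ρ_pos : 0 < ρ
  σ_pos : 0 < σ
  σ_lt_one : σ < 1
  G_zero : G 0 = 0
  G_lt_one : ∀ t, 0 ≤ t → G t < 1
  g_nonneg : ∀ t, 0 ≤ t → 0 ≤ g t
  hasDeriv_G : ∀ t, 0 ≤ t → HasDerivWithinAt G (g t) (Ici 0) t
  hazard_strictAnti : StrictAntiOn (fun t => g t / (1 - G t)) (Ici 0)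

/-- A mixed strategy over times in `[0, ∞]`: an absolutely continuous part with density `density`,
countably many atoms `atom`, and the remaining probability on the time `∞` ("never").
The density is the (right) derivative of the absolutely continuous part of the distribution
function, at every time at which that derivative exists. -/
structure TimeStrategy where
  density : ℝ → ℝ
  atom : ℝ → ℝ
  density_nonneg : ∀ t, 0 ≤ density t
  atom_nonneg : ∀ t, 0 ≤ atom t
  density_neg : ∀ t, t < 0 → density t = 0
  atom_neg : ∀ t, t < 0 → atom t = 0
  density_integrable : Integrable density
  atom_summable : Summable atom
  mass_le_one : (∫ t, density t) + ∑' t, atom t ≤ 1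
  density_eq_deriv : ∀ t, 0 ≤ t → ∀ d : ℝ,
    HasDerivWithinAt (fun x => ∫ s in (0 : ℝ)..x, density s) d (Ici t) t → density t = d

namespace TimeStrategy

/-- Distribution function: the probability of times in `[0, t]`. -/
def cdf (F : TimeStrategy) (t : ℝ) : ℝ :=
  (∫ s in (0 : ℝ)..t, F.density s) + ∑' s, (Iic t).indicator F.atom s

/-- Probability of the time `∞`. -/
def never (F : TimeStrategy) : ℝ :=
  1 - ((∫ t, F.density t) + ∑' t, F.atom t)

/-- The strategy puts positive density or positive probability on the time `t`. -/
def Charges (F : TimeStrategy) (t : ℝ) : Prop :=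
  0 < F.density t ∨ 0 < F.atom t

/-- The strategy as a law on `[0, ∞]` has support exactly `S ⊆ [0, ∞)`: nothing sits at `∞`, and
`S` is the set of times all of whose neighbourhoods have positive probability. -/
def HasSupport (F : TimeStrategy) (S : Set ℝ) : Prop :=
  F.never = 0 ∧ {t : ℝ | ∀ ε, 0 < ε → F.cdf (t - ε) < F.cdf (t + ε)} = S

end TimeStrategy

/-- A strategy profile: the probability `act t` with which the principal selects risky after type-1
news at `t`, her stopping strategy `stopping`, and the agent's faking strategy `faking`. -/
structure Profile where
  act : ℝ → ℝ
  act_measurable : Measurable act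
  act_mem : ∀ t, act t ∈ Icc (0 : ℝ) 1
  stopping : TimeStrategy
  faking : TimeStrategy

namespace SearchGame

variable (M : SearchGame)

/-- Hazard rate `H_R` of real news. -/
def hazard (t : ℝ) : ℝ := M.g t / (1 - M.G t)

def φP : ℝ := M.ρ * M.θ / (M.μ * (1 - M.θ))

def φA : ℝ := M.ρ * M.μ / (M.β * (1 - M.μ))

/-- `H_R(0) > φ_P > H_R(∞)`. -/
def A1 : Prop :=
  M.φP < M.hazard 0 ∧ ∃ L : ℝ, Tendsto M.hazard atTop (𝓝 L) ∧ L < M.φP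

/-- `φ_P > φ_A`. -/
def A2 : Prop := M.φA < M.φP

/-! ### The principal's first-best benchmark -/

/-- Principal's first-best payoff of search duration `t`. -/
def uFB (t : ℝ) : ℝ :=
  (∫ x in (0 : ℝ)..t, Real.exp (-M.ρ * x) * M.g x * (M.μ + (1 - M.μ) * M.θ))
    + Real.exp (-M.ρ * t) * (1 - M.G t) * M.θ

/-- Principal's first-best payoff of searching forever. -/
def uFBNever : ℝ :=
  ∫ x in Ioi (0 : ℝ), Real.exp (-M.ρ * x) * M.g x * (M.μ + (1 - M.μ) * M.θ)

/-- `τ` is the (unique) optimal search duration in the principal's first-best benchmark. -/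
def IsFirstBestDuration (τ : ℝ) : Prop :=
  0 ≤ τ ∧ (∀ t, 0 ≤ t → t ≠ τ → M.uFB t < M.uFB τ) ∧ M.uFBNever < M.uFB τ

/-! ### News and beliefs -/

/-- Prior probability of the state `ω ∈ {0, 1}`. -/
def prior (ω : Fin 2) : ℝ := if ω = 1 then M.μ else 1 - M.μ

/-- Density at `t` of the event that the state is `ω` and type-`k` news arrives at `t`.
First summand: real news, which is of type `ω`, arrives and fake news takes longer.
Second summand: fake news, which is of type `1`, arrives and real news takes longer. -/
def newsDensity (F : TimeStrategy) (ω k : Fin 2) (t : ℝ) : ℝ :=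
  M.prior ω * ((if k = ω then M.g t * (1 - M.σ * F.cdf t) else 0)
    + (if k = 1 then M.σ * F.density t * (1 - M.G t) else 0))

/-- Probability that the state is `ω` and type-`k` news arrives exactly at `t`. -/
def newsAtom (F : TimeStrategy) (ω k : Fin 2) (t : ℝ) : ℝ :=
  M.prior ω * (if k = 1 then M.σ * F.atom t * (1 - M.G t) else 0)

/-- Bayesian posterior probability of `ω = 1` after type-`k` news at `t`, given the faking strategy
`F`: the ratio of the probabilities if type-`k` news has an atom at `t`, and otherwise the ratio
of the densities. -/
def posterior (F : TimeStrategy) (k : Fin 2) (t : ℝ) : ℝ :=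
  open Classical in
  if 0 < ∑ ω, M.newsAtom F ω k t then
    M.newsAtom F 1 k t / ∑ ω, M.newsAtom F ω k t
  else
    M.newsDensity F 1 k t / ∑ ω, M.newsDensity F ω k t

/-! ### Payoffs -/

/-- Principal's expected payoff from type-1 news at `s`: safe pays `θ`, risky pays the posterior. -/
def newsValue (E : Profile) (s : ℝ) : ℝ :=
  (1 - E.act s) * M.θ + E.act s * M.posterior E.faking 1 s

/-- Principal's flow of discounted payoffs at `s`, absolutely continuous part. -/
def flowP (E : Profile) (s : ℝ) : ℝ :=
  Real.exp (-M.ρ * s) * ((∑ ω, M.newsDensity E.faking ω 0 s) * M.θ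
    + (∑ ω, M.newsDensity E.faking ω 1 s) * M.newsValue E s)

/-- Principal's flow of discounted payoffs at `s`, atoms. -/
def flowAtomP (E : Profile) (s : ℝ) : ℝ :=
  Real.exp (-M.ρ * s) * ((∑ ω, M.newsAtom E.faking ω 1 s) * M.newsValue E s)

/-- Principal's expected payoff of stopping at `t` without news. -/
def uP (E : Profile) (t : ℝ) : ℝ :=
  (∫ s in (0 : ℝ)..t, M.flowP E s) + (∑' s, (Iic t).indicator (M.flowAtomP E) s)
    + Real.exp (-M.ρ * t) * ((1 - M.G t) * (1 - M.σ * E.faking.cdf t)) * M.θ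

/-- Principal's expected payoff of never stopping without news. -/
def uPNever (E : Profile) : ℝ :=
  (∫ s in Ioi (0 : ℝ), M.flowP E s) + ∑' s, M.flowAtomP E s

/-- Agent's flow of discounted payoffs at `s`, absolutely continuous part: real type-0 news, real
type-1 news, and stopping by the principal. -/
def flowA (E : Profile) (s : ℝ) : ℝ :=
  Real.exp (-M.ρ * s) * ((1 - M.μ) * M.g s * (1 - E.stopping.cdf s) * M.β
    + M.μ * M.g s * (1 - E.stopping.cdf s) * ((1 - E.act s) * M.β + E.act s)
    + E.stopping.density s * (1 - M.G s) * M.β)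

/-- Agent's flow of discounted payoffs at `s`, atoms of the principal's stopping. -/
def flowAtomA (E : Profile) (s : ℝ) : ℝ :=
  Real.exp (-M.ρ * s) * (E.stopping.atom s * (1 - M.G s) * M.β)

/-- Faking agent's expected payoff of faking at `t`. -/
def uA (E : Profile) (t : ℝ) : ℝ :=
  (∫ s in (0 : ℝ)..t, M.flowA E s) + (∑' s, (Iic t).indicator (M.flowAtomA E) s)
    + Real.exp (-M.ρ * t) * ((1 - M.G t) * (1 - E.stopping.cdf t))
      * ((1 - E.act t) * M.β + M.μ * E.act t)

/-- Faking agent's expected payoff of never faking. -/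
def uANever (E : Profile) : ℝ :=
  (∫ s in Ioi (0 : ℝ), M.flowA E s) + ∑' s, M.flowAtomA E s

end SearchGame

/-- A mixed strategy is optimal for the payoff `u` on `[0, ∞)`, `uNever` at `∞`: each time with
positive density or probability is a best time in `[0, ∞]`. -/
def TimeStrategy.IsOptimal (F : TimeStrategy) (u : ℝ → ℝ) (uNever : ℝ) : Prop :=
  (∀ t, 0 ≤ t → F.Charges t → (∀ t', 0 ≤ t' → u t' ≤ u t) ∧ uNever ≤ u t) ∧
  (0 < F.never → ∀ t', 0 ≤ t' → u t' ≤ uNever)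

namespace SearchGame

variable (M : SearchGame)

/-- Equilibrium: optimal faking, optimal response to type-1 news, optimal stopping. -/
structure IsEquilibrium (E : Profile) : Prop where
  faking_optimal : E.faking.IsOptimal (M.uA E) (M.uANever E)
  act_eq_one : ∀ t, 0 ≤ t → M.θ < M.posterior E.faking 1 t → E.act t = 1
  act_eq_zero : ∀ t, 0 ≤ t → M.posterior E.faking 1 t < M.θ → E.act t = 0
  stopping_optimal : E.stopping.IsOptimal (M.uP E) (M.uPNever E)

/-- Principal's expected payoff in the profile `E`. -/
def payoffP (E : Profile) : ℝ :=
  (∫ t in Ioi (0 : ℝ), M.uP E t * E.stopping.density t)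
    + (∑' t, E.stopping.atom t * M.uP E t) + E.stopping.never * M.uPNever E

/-- The principal benefits from search: her payoff exceeds that of choosing safe at once. -/
def BeneficialSearch (E : Profile) : Prop := M.θ < M.payoffP E

end SearchGame

end

/-! The argument rests on writing both payoffs as integrals of marginal values. For the principal,
`ActOptimal.uP_eq` gives `θ` plus the integral of `marginP`, with no atomic term: fake news at an
atom has posterior `μ < θ`, is rejected and yields the same `θ` as stopping. Hence `uP` is
continuous and every point of the support of the stopping law maximizes it
(`IsEquilibrium.isMaxOn_uP`). For the agent, `uA_eq` gives an integral of `marginA` plus a premium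
proportional to the acceptance probability at the faking time.

Let `τ` solve `hazard τ = φP`, and let `T` be the support of the stopping law. Beneficial search
excludes `0` from `T`; times beyond `τ` are excluded because even undiluted real news is then too
rare to justify waiting. Just before a maximizer of `uP` type-1 news must sometimes be accepted for
sure, since `uP` falls strictly while it is not.

At `sup T` the principal has surely stopped, so faking from then on is strictly worse than faking at
an accepted time shortly before. No faking from `sup T` on makes search valuable up to `τ`, whence
`sup T = τ`. On a gap of `T` ending at a point of `T`, the condition `φA < φP` makes waiting better
than faking (`IsEquilibrium.not_charges_of_cdf_const`). Without fakes `uP` increases strictly across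
the gap, so its left end cannot be optimal. Thus `T` is an interval `[m, τ]`, and faking occurs only
in `[m, τ)`; were `m = τ`, the agent would never fake, which is not optimal either.

An atom of faking would be rejected, while slightly later times are accepted, so there are none.
Constancy of `uP` on `[m, τ]` determines the fake-news density almost everywhere, and the
right-derivative convention upgrades this to every point of `[m, τ)`. Bayes' rule then gives the
posterior, and all qualitative claims follow from the hazard rate being continuous and strictly
decreasing. -/

/-- A strictly antitone derivative on a half-line is continuous there (Darboux). -/
theorem StrictAntiOn.continuousOn_of_hasDerivWithinAt {f f' : ℝ → ℝ} {s : Set ℝ}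
    (hs : s.OrdConnected) (hf : ∀ x ∈ s, HasDerivWithinAt f (f' x) s x)
    (hm : StrictAntiOn f' s) : ContinuousOn f' s := by
  have hm' : StrictMonoOn (fun x => -f' x) s := fun x hx y hy hxy => neg_lt_neg (hm hx hy hxy)
  have hoc : ((fun x => -f' x) '' s).OrdConnected :=
    hs.image_hasDerivWithinAt (f := fun x => -f x) fun x hx => (hf x hx).neg
  have hc := (StrictMonoOn.orderIso _ s hm').continuous
  have : ContinuousOn (fun x => -f' x) s := by
    rw [continuousOn_iff_continuous_domRestrict]
    exact continuous_subtype_val.comp hc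
  exact this.neg.congr fun x _ => (neg_neg _).symm

/-! ### Hazard rate and discount factor. -/

namespace SearchGame

variable (M : SearchGame)

theorem θ_pos : 0 < M.θ := M.β_pos.trans (M.β_lt_μ.trans M.μ_lt_θ)
theorem μ_pos : 0 < M.μ := M.β_pos.trans M.β_lt_μ
theorem μ_lt_one : M.μ < 1 := M.μ_lt_θ.trans M.θ_lt_one
theorem β_lt_one : M.β < 1 := M.β_lt_μ.trans M.μ_lt_one

theorem one_sub_G_pos {t : ℝ} (ht : 0 ≤ t) : 0 < 1 - M.G t := sub_pos.2 (M.G_lt_one t ht)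

theorem hazard_nonneg {t : ℝ} (ht : 0 ≤ t) : 0 ≤ M.hazard t :=
  div_nonneg (M.g_nonneg t ht) (M.one_sub_G_pos ht).le

theorem hazard_lt {s t : ℝ} (hs : 0 ≤ s) (hst : s < t) : M.hazard t < M.hazard s :=
  M.hazard_strictAnti hs (hs.trans hst.le) hst

theorem hazard_le {s t : ℝ} (hs : 0 ≤ s) (hst : s ≤ t) : M.hazard t ≤ M.hazard s :=
  M.hazard_strictAnti.antitoneOn hs (hs.trans hst) hst

theorem hazard_pos {t : ℝ} (ht : 0 ≤ t) : 0 < M.hazard t :=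
  (M.hazard_nonneg (by linarith : 0 ≤ t + 1)).trans_lt (M.hazard_lt ht (by linarith))

theorem g_eq {t : ℝ} (ht : 0 ≤ t) : M.g t = M.hazard t * (1 - M.G t) := by
  rw [hazard, div_mul_cancel₀ _ (M.one_sub_G_pos ht).ne']

theorem g_pos {t : ℝ} (ht : 0 ≤ t) : 0 < M.g t := by
  rw [M.g_eq ht]; exact mul_pos (M.hazard_pos ht) (M.one_sub_G_pos ht)

theorem G_continuousOn : ContinuousOn M.G (Ici 0) :=
  fun t ht => (M.hasDeriv_G t ht).continuousWithinAt

/-- The hazard rate is the derivative of the cumulative hazard `-log (1 - G)`, so it has the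
intermediate value property; monotonicity then rules out jumps. Continuity of `g` is not among the
assumptions. -/
theorem hazard_continuousOn : ContinuousOn M.hazard (Ici 0) := by
  refine StrictAntiOn.continuousOn_of_hasDerivWithinAt (f := fun t => -Real.log (1 - M.G t))
    ordConnected_Ici (fun t ht => ?_) M.hazard_strictAnti
  have := (((M.hasDeriv_G t ht).const_sub 1).log (M.one_sub_G_pos ht).ne').neg
  exact this.congr_deriv (by simp only [hazard]; ring)

theorem G_hasDerivAt {t : ℝ} (ht : 0 < t) : HasDerivAt M.G (M.g t) t :=
  (M.hasDeriv_G t ht.le).hasDerivAt (Ici_mem_nhds ht)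

theorem G_monotoneOn : MonotoneOn M.G (Ici 0) := by
  refine monotoneOn_of_deriv_nonneg (convex_Ici 0) M.G_continuousOn ?_ ?_
  · rw [interior_Ici]
    exact fun t ht => (M.G_hasDerivAt ht).differentiableAt.differentiableWithinAt
  · rw [interior_Ici]
    intro t ht
    rw [(M.G_hasDerivAt ht).deriv]
    exact M.g_nonneg t (le_of_lt ht)

theorem G_nonneg {t : ℝ} (ht : 0 ≤ t) : 0 ≤ M.G t := by
  rw [← M.G_zero]; exact M.G_monotoneOn self_mem_Ici ht ht

/-- A nonnegative derivative of a bounded function is integrable. The truncation `max t 0` is needed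
because `G` is constrained only on `[0, ∞)`. -/
theorem g_integrableOn : IntegrableOn M.g (Ioi 0) := by
  have hbdd : BddAbove (range fun t : ℝ => M.G (max t 0)) :=
    ⟨1, by rintro _ ⟨t, rfl⟩; exact (M.G_lt_one _ (le_max_right _ _)).le⟩
  have hmono : Monotone fun t : ℝ => M.G (max t 0) := fun s t hst =>
    M.G_monotoneOn (le_max_right s 0) (le_max_right t 0) (max_le_max_right 0 hst)
  have hlim := tendsto_atTop_ciSup hmono hbdd
  refine integrableOn_Ioi_deriv_of_nonneg (M.G_continuousOn 0 self_mem_Ici)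
    (fun t ht => M.G_hasDerivAt ht) (fun t ht => M.g_nonneg t (le_of_lt ht)) (hlim.congr' ?_)
  filter_upwards [eventually_ge_atTop 0] with t ht
  rw [max_eq_left ht]

/-- Discounted probability that no real news has arrived. -/
noncomputable def disc (t : ℝ) : ℝ := Real.exp (-M.ρ * t) * (1 - M.G t)

theorem disc_pos {t : ℝ} (ht : 0 ≤ t) : 0 < M.disc t :=
  mul_pos (Real.exp_pos _) (M.one_sub_G_pos ht)

theorem disc_zero : M.disc 0 = 1 := by simp [disc, M.G_zero]

theorem disc_hasDerivWithinAt {t : ℝ} (ht : 0 ≤ t) :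
    HasDerivWithinAt M.disc (-((M.ρ + M.hazard t) * M.disc t)) (Ici 0) t := by
  have h1 : HasDerivWithinAt (fun t => Real.exp (-M.ρ * t)) (Real.exp (-M.ρ * t) * (-M.ρ))
      (Ici 0) t := by
    simpa using (((hasDerivAt_id t).const_mul (-M.ρ)).exp).hasDerivWithinAt (s := Ici 0)
  have := h1.mul ((M.hasDeriv_G t ht).const_sub 1)
  exact this.congr_deriv (by simp only [disc, M.g_eq ht]; ring)

theorem disc_continuousOn : ContinuousOn M.disc (Ici 0) :=
  fun _ ht => (M.disc_hasDerivWithinAt ht).continuousWithinAt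

theorem continuousOn_decay : ContinuousOn (fun s => (M.ρ + M.hazard s) * M.disc s) (Ici 0) :=
  (continuousOn_const.add M.hazard_continuousOn).mul M.disc_continuousOn

theorem uIcc_subset_Ici {s t : ℝ} (hs : 0 ≤ s) (ht : 0 ≤ t) : uIcc s t ⊆ Ici 0 :=
  fun _ hx => (le_min hs ht).trans hx.1

theorem intervalIntegrable_of_continuousOn {f : ℝ → ℝ} (hf : ContinuousOn f (Ici 0)) {s t : ℝ}
    (hs : 0 ≤ s) (ht : 0 ≤ t) : IntervalIntegrable f volume s t :=
  (hf.mono (uIcc_subset_Ici hs ht)).intervalIntegrable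

theorem integral_decay {s t : ℝ} (hs : 0 ≤ s) (ht : 0 ≤ t) :
    ∫ x in s..t, (M.ρ + M.hazard x) * M.disc x = M.disc s - M.disc t := by
  have := intervalIntegral.integral_eq_sub_of_hasDeriv_right
    (f := fun x => -M.disc x) (f' := fun x => (M.ρ + M.hazard x) * M.disc x) (a := s) (b := t)
    (M.disc_continuousOn.neg.mono (uIcc_subset_Ici hs ht)) (fun x hx => ?_)
    (intervalIntegrable_of_continuousOn M.continuousOn_decay hs ht)
  · rw [this]; ring
  · have hx0 : 0 ≤ x := (le_min hs ht).trans hx.1.le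
    have := (M.disc_hasDerivWithinAt hx0).neg
    rw [neg_neg] at this
    exact this.mono fun y hy => hx0.trans (le_of_lt hy)

theorem disc_antitoneOn : AntitoneOn M.disc (Ici 0) := by
  intro s hs t ht hst
  have := M.integral_decay hs ht
  have h0 : 0 ≤ ∫ x in s..t, (M.ρ + M.hazard x) * M.disc x :=
    intervalIntegral.integral_nonneg hst fun x hx => by
      have hx0 : 0 ≤ x := le_trans hs hx.1
      exact mul_nonneg (add_nonneg M.ρ_pos.le (M.hazard_nonneg hx0)) (M.disc_pos hx0).le
  linarith

theorem disc_le_one {t : ℝ} (ht : 0 ≤ t) : M.disc t ≤ 1 := by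
  rw [← M.disc_zero]; exact M.disc_antitoneOn self_mem_Ici ht ht

theorem exp_mul_g_eq {t : ℝ} (ht : 0 ≤ t) :
    Real.exp (-M.ρ * t) * M.g t = M.hazard t * M.disc t := by
  rw [M.g_eq ht, disc]; ring

theorem tendsto_disc : Tendsto M.disc atTop (𝓝 0) := by
  have h : Tendsto (fun t => Real.exp (-M.ρ * t)) atTop (𝓝 0) :=
    Real.tendsto_exp_atBot.comp (tendsto_id.const_mul_atTop_of_neg (neg_lt_zero.2 M.ρ_pos))
  refine squeeze_zero' ?_ ?_ h
  · filter_upwards [eventually_ge_atTop 0] with t ht using (M.disc_pos ht).le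
  · filter_upwards [eventually_ge_atTop 0] with t ht
    have := M.G_nonneg ht
    exact mul_le_of_le_one_right (Real.exp_pos _).le (by linarith)

/-! ### Thresholds and the first-best benchmark. -/

theorem φP_pos : 0 < M.φP :=
  div_pos (mul_pos M.ρ_pos M.θ_pos) (mul_pos M.μ_pos (sub_pos.2 M.θ_lt_one))

theorem φP_mul : M.μ * (1 - M.θ) * M.φP = M.ρ * M.θ := by
  have h1 := M.μ_pos
  have h2 := sub_pos.2 M.θ_lt_one
  rw [φP]; field_simp

theorem φA_mul : M.β * (1 - M.μ) * M.φA = M.ρ * M.μ := by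
  have h1 := M.β_pos
  have h2 := sub_pos.2 M.μ_lt_one
  rw [φA]; field_simp

theorem exists_hazard_eq (h : M.A1) : ∃ τ, 0 < τ ∧ M.hazard τ = M.φP := by
  obtain ⟨h0, L, hL, hlt⟩ := h
  obtain ⟨T, hT, hT0⟩ := ((hL.eventually_lt_const hlt).and (eventually_gt_atTop 0)).exists
  obtain ⟨τ, hτ, hτe⟩ := intermediate_value_Icc' hT0.le
    (M.hazard_continuousOn.mono fun x hx => hx.1) ⟨hT.le, h0.le⟩
  refine ⟨τ, lt_of_le_of_ne hτ.1 ?_, hτe⟩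
  rintro rfl
  exact absurd hτe h0.ne'

/-- The terminal payoff is absorbed through the derivative of `disc`. The resulting integrand has
the sign of `hazard s - φP`, which changes exactly once. -/
theorem uFB_eq {t : ℝ} (ht : 0 ≤ t) :
    M.uFB t = M.θ + ∫ s in (0 : ℝ)..t, M.disc s * (M.μ * (1 - M.θ) * M.hazard s - M.ρ * M.θ) := by
  have h1 := M.integral_decay le_rfl ht
  have i1 := intervalIntegrable_of_continuousOn M.continuousOn_decay le_rfl ht
  have e1 : ∫ x in (0 : ℝ)..t, Real.exp (-M.ρ * x) * M.g x * (M.μ + (1 - M.μ) * M.θ)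
      = ∫ s in (0 : ℝ)..t, (M.disc s * (M.μ * (1 - M.θ) * M.hazard s - M.ρ * M.θ)
        + M.θ * ((M.ρ + M.hazard s) * M.disc s)) := by
    refine intervalIntegral.integral_congr fun x hx => ?_
    have hx0 := uIcc_subset_Ici le_rfl ht hx
    rw [M.exp_mul_g_eq hx0]; ring
  rw [uFB, e1, intervalIntegral.integral_add _ (i1.const_mul _),
    intervalIntegral.integral_const_mul, h1, disc_zero]
  · change _ + M.disc t * M.θ = _
    ring
  · exact intervalIntegrable_of_continuousOn (M.disc_continuousOn.mul
      ((continuousOn_const.mul M.hazard_continuousOn).sub continuousOn_const)) le_rfl ht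

theorem uFB_sub {s t : ℝ} (hs : 0 ≤ s) (ht : 0 ≤ t) : M.uFB t - M.uFB s =
    ∫ x in s..t, M.disc x * (M.μ * (1 - M.θ) * (M.hazard x - M.φP)) := by
  have hc : ContinuousOn (fun s => M.disc s * (M.μ * (1 - M.θ) * M.hazard s - M.ρ * M.θ))
      (Ici 0) := M.disc_continuousOn.mul
      ((continuousOn_const.mul M.hazard_continuousOn).sub continuousOn_const)
  rw [M.uFB_eq hs, M.uFB_eq ht, add_sub_add_left_eq_sub, intervalIntegral.integral_interval_sub_left
    (intervalIntegrable_of_continuousOn hc le_rfl ht)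
    (intervalIntegrable_of_continuousOn hc le_rfl hs)]
  refine intervalIntegral.integral_congr fun x _ => ?_
  simp only [← M.φP_mul]; ring

theorem intervalIntegrable_uFB {s t : ℝ} (hs : 0 ≤ s) (ht : 0 ≤ t) :
    IntervalIntegrable (fun x => M.disc x * (M.μ * (1 - M.θ) * (M.hazard x - M.φP))) volume s t :=
  intervalIntegrable_of_continuousOn (M.disc_continuousOn.mul
      (continuousOn_const.mul (M.hazard_continuousOn.sub continuousOn_const))) hs ht

theorem uFB_lt_of_le {τ : ℝ} (hτ0 : 0 < τ) (hτ : M.hazard τ = M.φP) {s t : ℝ}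
    (hs : τ ≤ s) (hst : s < t) : M.uFB t < M.uFB s := by
  have hs0 : 0 ≤ s := hτ0.le.trans hs
  have ht0 : 0 ≤ t := hs0.trans hst.le
  have h1 := M.uFB_sub hs0 ht0
  have h2 := intervalIntegral.intervalIntegral_pos_of_pos_on
    (M.intervalIntegrable_uFB hs0 ht0).neg (fun x hx => ?_) hst
  · change 0 < ∫ x in s..t, -(_ : ℝ) at h2
    rw [intervalIntegral.integral_neg] at h2
    linarith
  · have hx0 : 0 ≤ x := hs0.trans hx.1.le
    have := M.hazard_lt hτ0.le (hs.trans_lt hx.1)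
    rw [hτ] at this
    simp only [Pi.neg_apply]
    have := mul_pos (M.disc_pos hx0) (mul_pos (mul_pos M.μ_pos (sub_pos.2 M.θ_lt_one))
      (sub_pos.2 this))
    linarith

theorem uFB_lt_of_lt {τ : ℝ} (hτ0 : 0 < τ) (hτ : M.hazard τ = M.φP)
    {s : ℝ} (hs0 : 0 ≤ s) (hst : s < τ) : M.uFB s < M.uFB τ := by
  have h1 := M.uFB_sub hs0 hτ0.le
  have h2 := intervalIntegral.intervalIntegral_pos_of_pos_on
    (M.intervalIntegrable_uFB hs0 hτ0.le) (fun x hx => ?_) hst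
  · linarith
  · have hx0 : 0 ≤ x := hs0.trans hx.1.le
    have := M.hazard_lt hx0 hx.2
    rw [hτ] at this
    exact mul_pos (M.disc_pos hx0) (mul_pos (mul_pos M.μ_pos (sub_pos.2 M.θ_lt_one))
      (sub_pos.2 this))

theorem isFirstBestDuration_of_hazard_eq {τ : ℝ} (hτ0 : 0 < τ) (hτ : M.hazard τ = M.φP) :
    M.IsFirstBestDuration τ := by
  refine ⟨hτ0.le, fun t ht htτ => ?_, ?_⟩
  · rcases lt_or_gt_of_ne htτ with h | h
    · exact M.uFB_lt_of_lt hτ0 hτ ht h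
    · exact M.uFB_lt_of_le hτ0 hτ le_rfl h
  · have hi : IntegrableOn (fun x => Real.exp (-M.ρ * x) * M.g x * (M.μ + (1 - M.μ) * M.θ))
        (Ioi 0) := by
      refine Integrable.mul_const ?_ _
      refine Integrable.bdd_mul (c := 1) M.g_integrableOn (by fun_prop) ?_
      filter_upwards [ae_restrict_mem measurableSet_Ioi] with x hx
      rw [Real.norm_eq_abs, Real.abs_exp, Real.exp_le_one_iff]
      have := mul_pos M.ρ_pos hx
      linarith
    have hlim : Tendsto M.uFB atTop (𝓝 M.uFBNever) := by
      have := (intervalIntegral_tendsto_integral_Ioi 0 hi tendsto_id).add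
        (M.tendsto_disc.mul_const M.θ)
      rw [zero_mul, add_zero] at this
      exact this
    refine lt_of_le_of_lt (le_of_tendsto hlim ?_)
      (M.uFB_lt_of_le hτ0 hτ le_rfl (lt_add_one τ))
    filter_upwards [eventually_gt_atTop (τ + 1)] with t ht
    exact (M.uFB_lt_of_le hτ0 hτ (by linarith) ht).le

end SearchGame

/-! ### Mixed strategies as finite measures. -/

namespace TimeStrategy

variable (F : TimeStrategy)

/-- The law of the strategy on `[0, ∞)`. -/
noncomputable def law : Measure ℝ :=
  volume.withDensity (fun t => ENNReal.ofReal (F.density t))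
    + Measure.sum fun s => ENNReal.ofReal (F.atom s) • Measure.dirac s

theorem aemeasurable_ofReal_density :
    AEMeasurable (fun t => ENNReal.ofReal (F.density t)) volume :=
  F.density_integrable.aestronglyMeasurable.aemeasurable.ennreal_ofReal

theorem law_univ : F.law univ = ENNReal.ofReal ((∫ t, F.density t) + ∑' t, F.atom t) := by
  rw [law, Measure.add_apply, withDensity_apply _ MeasurableSet.univ, Measure.restrict_univ,
    Measure.sum_apply _ MeasurableSet.univ,
    ENNReal.ofReal_add (integral_nonneg F.density_nonneg) (tsum_nonneg F.atom_nonneg),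
    ofReal_integral_eq_lintegral_ofReal F.density_integrable (ae_of_all _ F.density_nonneg),
    ENNReal.ofReal_tsum_of_nonneg F.atom_nonneg F.atom_summable]
  simp

instance : IsFiniteMeasure F.law := ⟨by rw [F.law_univ]; exact ENNReal.ofReal_lt_top⟩

theorem law_real_univ : F.law.real univ = (∫ t, F.density t) + ∑' t, F.atom t := by
  rw [measureReal_def, law_univ, ENNReal.toReal_ofReal]
  exact add_nonneg (integral_nonneg F.density_nonneg) (tsum_nonneg F.atom_nonneg)

theorem never_eq : F.never = 1 - F.law.real univ := by rw [never, law_real_univ]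

theorem integral_law {φ : ℝ → ℝ} (hφ : Integrable φ F.law) :
    ∫ t, φ t ∂F.law = (∫ t, F.density t * φ t) + ∑' t, F.atom t * φ t := by
  have h2 := hφ.right_of_add_measure
  rw [law, integral_add_measure hφ.left_of_add_measure h2, integral_sum_measure h2,
    integral_withDensity_eq_integral_toReal_smul₀ F.aemeasurable_ofReal_density
      (ae_of_all _ fun _ => ENNReal.ofReal_lt_top)]
  congr 1
  · refine integral_congr_ae (ae_of_all _ fun t => ?_)
    simp only [ENNReal.toReal_ofReal (F.density_nonneg t), smul_eq_mul]
  · refine tsum_congr fun t => ?_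
    rw [integral_smul_measure, integral_dirac, ENNReal.toReal_ofReal (F.atom_nonneg t),
      smul_eq_mul]

theorem setIntegral_law {φ : ℝ → ℝ} {A : Set ℝ} (hA : MeasurableSet A)
    (hφ : IntegrableOn φ A F.law) :
    ∫ t in A, φ t ∂F.law = (∫ t in A, F.density t * φ t)
      + ∑' t, A.indicator (fun s => F.atom s * φ s) t := by
  rw [← integral_indicator hA, F.integral_law (hφ.integrable_indicator hA),
    ← integral_indicator hA]
  congr 1
  · refine integral_congr_ae (ae_of_all _ fun t => ?_)
    by_cases h : t ∈ A <;> simp [h]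
  · refine tsum_congr fun t => ?_
    by_cases h : t ∈ A <;> simp [h]

theorem density_eq_zero {t : ℝ} (h : ¬ F.Charges t) : F.density t = 0 :=
  le_antisymm (not_lt.1 fun h' => h (Or.inl h')) (F.density_nonneg t)

theorem atom_eq_zero {t : ℝ} (h : ¬ F.Charges t) : F.atom t = 0 :=
  le_antisymm (not_lt.1 fun h' => h (Or.inr h')) (F.atom_nonneg t)

theorem Charges.nonneg {F : TimeStrategy} {t : ℝ} (h : F.Charges t) : 0 ≤ t := by
  by_contra! ht
  rcases h with h | h
  · exact h.ne' (F.density_neg t ht)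
  · exact h.ne' (F.atom_neg t ht)

/-- This is the bridge from the pointwise optimality conditions, stated for charged times, to
statements about the law and its support. -/
theorem law_eq_zero {A : Set ℝ} (hA : MeasurableSet A) (h : ∀ t ∈ A, ¬ F.Charges t) :
    F.law A = 0 := by
  rw [law, Measure.add_apply, withDensity_apply _ hA, Measure.sum_apply _ hA, add_eq_zero]
  constructor
  · rw [setLIntegral_congr_fun hA (g := fun _ => 0), lintegral_zero]
    intro t ht
    simp only [F.density_eq_zero (h t ht), ENNReal.ofReal_zero]
  · rw [ENNReal.tsum_eq_zero]
    intro t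
    by_cases ht : t ∈ A
    · simp [F.atom_eq_zero (h t ht)]
    · simp [ht]

theorem law_Iio : F.law (Iio 0) = 0 :=
  F.law_eq_zero measurableSet_Iio fun _ ht h => not_le_of_gt ht h.nonneg

theorem exists_charges_of_law_ne_zero {A : Set ℝ} (hA : MeasurableSet A) (h : F.law A ≠ 0) :
    ∃ t ∈ A, F.Charges t := by
  by_contra! h'
  exact h (F.law_eq_zero hA h')

theorem setIntegral_Iic_density : ∫ t in Iic (0 : ℝ), F.density t = 0 := by
  rw [integral_Iic_eq_integral_Iio, setIntegral_eq_zero_of_forall_eq_zero]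
  exact F.density_neg

theorem cdf_eq (t : ℝ) : F.cdf t = F.law.real (Iic t) := by
  have h := F.setIntegral_law (φ := fun _ => 1) (A := Iic t) measurableSet_Iic
    (integrable_const _).integrableOn
  have h1 := intervalIntegral.integral_Iic_sub_Iic (a := 0) (b := t)
    F.density_integrable.integrableOn F.density_integrable.integrableOn
  rw [F.setIntegral_Iic_density, sub_zero] at h1
  simp only [integral_const, smul_eq_mul, mul_one, measureReal_restrict_apply_univ, h1] at h
  rw [h, cdf]

theorem cdf_mono : Monotone F.cdf := fun s t h => by
  rw [F.cdf_eq, F.cdf_eq]; exact measureReal_mono (Iic_subset_Iic.2 h)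

theorem cdf_nonneg (t : ℝ) : 0 ≤ F.cdf t := by rw [F.cdf_eq]; exact measureReal_nonneg

theorem law_real_univ_le_one : F.law.real univ ≤ 1 := by
  rw [F.law_real_univ]; exact F.mass_le_one

theorem cdf_le (t : ℝ) : F.cdf t ≤ F.law.real univ := by
  rw [F.cdf_eq]; exact measureReal_mono (subset_univ _)

theorem cdf_le_one (t : ℝ) : F.cdf t ≤ 1 := (F.cdf_le t).trans F.law_real_univ_le_one

theorem cdf_sub {s t : ℝ} (h : s ≤ t) : F.cdf t - F.cdf s = F.law.real (Ioc s t) := by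
  have h1 : Iic t \ Iic s = Ioc s t := by ext x; simp [and_comm]
  rw [F.cdf_eq, F.cdf_eq, ← h1, measureReal_sdiff (Iic_subset_Iic.2 h) measurableSet_Iic]

theorem measurable_cdf : Measurable F.cdf := F.cdf_mono.measurable

theorem cdf_lt_iff {s t : ℝ} (h : s ≤ t) : F.cdf s < F.cdf t ↔ F.law (Ioc s t) ≠ 0 := by
  rw [← sub_pos, F.cdf_sub h, measureReal_def, ENNReal.toReal_pos_iff]
  simp [pos_iff_ne_zero, measure_lt_top]

theorem cdf_eq_of_law_eq_zero {s t : ℝ} (h : s ≤ t) (h0 : F.law (Ioc s t) = 0) :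
    F.cdf t = F.cdf s := by
  have := F.cdf_sub h
  rw [measureReal_def, h0, ENNReal.toReal_zero] at this
  linarith

theorem tendsto_cdf_right (t : ℝ) : Tendsto F.cdf (𝓝[>] t) (𝓝 (F.cdf t)) := by
  have h := tendsto_measure_biInter_gt (μ := F.law) (s := fun r => Iic r) (a := t)
    (fun r _ => measurableSet_Iic.nullMeasurableSet) (fun i j _ hij => Iic_subset_Iic.2 hij)
    ⟨t + 1, by linarith, measure_ne_top _ _⟩
  have h2 : ⋂ r > t, Iic r = Iic t := by
    ext x
    simp only [mem_iInter, mem_Iic]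
    exact ⟨fun hx => le_of_forall_gt_imp_ge_of_dense hx, fun hx r hr => hx.trans hr.le⟩
  rw [h2] at h
  have := (ENNReal.tendsto_toReal (measure_ne_top F.law (Iic t))).comp h
  rw [F.cdf_eq]
  refine this.congr fun x => ?_
  rw [F.cdf_eq]; rfl

theorem setOf_support_eq :
    {t : ℝ | ∀ ε, 0 < ε → F.cdf (t - ε) < F.cdf (t + ε)} = F.law.support := by
  ext t
  rw [mem_ofPred_eq, Measure.mem_support_iff_forall]
  constructor
  · intro h U hU
    obtain ⟨ε, hε, hsub⟩ := Metric.mem_nhds_iff.1 hU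
    have h1 := (F.cdf_lt_iff (by linarith)).1 (h (ε / 2) (by linarith))
    refine (pos_iff_ne_zero.2 h1).trans_le (measure_mono fun x hx => hsub ?_)
    rw [Metric.mem_ball, Real.dist_eq, abs_lt]
    constructor <;> linarith [hx.1, hx.2]
  · intro h ε hε
    refine (F.cdf_lt_iff (by linarith)).2 (h _ ?_).ne'
    exact Ioc_mem_nhds (by linarith) (by linarith)

theorem exists_charges_near {t : ℝ} (ht : t ∈ F.law.support) {ε : ℝ} (hε : 0 < ε) :
    ∃ s ∈ Ioo (t - ε) (t + ε), F.Charges s :=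
  F.exists_charges_of_law_ne_zero measurableSet_Ioo
    ((Measure.mem_support_iff_forall t).1 ht _
      (Ioo_mem_nhds (by linarith) (by linarith))).ne'

theorem countable_atom : {t | F.atom t ≠ 0}.Countable := F.atom_summable.countable_support

theorem ae_atom_eq_zero : ∀ᵐ t, F.atom t = 0 := by
  rw [ae_iff]; exact F.countable_atom.measure_zero _

theorem integrableOn_law {φ : ℝ → ℝ} (hφ : ContinuousOn φ (Ici 0)) (t : ℝ) :
    IntegrableOn φ (Icc 0 t) F.law :=
  (hφ.mono fun _ hx => hx.1).integrableOn_Icc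

theorem setIntegral_law_Icc {φ : ℝ → ℝ} (hφ : ContinuousOn φ (Ici 0)) {t : ℝ} (ht : 0 ≤ t) :
    ∫ s in Icc 0 t, φ s ∂F.law = (∫ s in (0 : ℝ)..t, F.density s * φ s)
      + ∑' s, (Iic t).indicator (fun s => F.atom s * φ s) s := by
  rw [F.setIntegral_law measurableSet_Icc (F.integrableOn_law hφ t),
    intervalIntegral.integral_of_le ht, integral_Icc_eq_integral_Ioc]
  congr 1
  refine tsum_congr fun s => ?_
  rcases lt_or_ge s 0 with h | h
  · simp [indicator, F.atom_neg s h]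
  · simp [indicator, h]

theorem law_real_Icc (t : ℝ) : F.law.real (Icc 0 t) = F.cdf t := by
  rw [F.cdf_eq]
  refine measureReal_congr ?_
  have h : ∀ᵐ x ∂F.law, x ∉ Iio (0 : ℝ) := measure_eq_zero_iff_ae_notMem.1 F.law_Iio
  filter_upwards [h] with x hx
  refine propext ⟨fun h => h.2, fun h => ⟨not_lt.1 hx, h⟩⟩

/-- Integration by parts of the discount factor against the law of a strategy. -/
theorem setIntegral_disc (M : SearchGame) {t : ℝ} (ht : 0 ≤ t) :
    ∫ s in Icc 0 t, M.disc s ∂F.law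
      = M.disc t * F.cdf t + ∫ u in (0 : ℝ)..t, (M.ρ + M.hazard u) * M.disc u * F.cdf u := by
  set D : ℝ → ℝ := fun u => (M.ρ + M.hazard u) * M.disc u with hD
  have hDi : Integrable D (volume.restrict (Ioc 0 t)) :=
    (intervalIntegrable_iff_integrableOn_Ioc_of_le ht).1
      (SearchGame.intervalIntegrable_of_continuousOn M.continuousOn_decay le_rfl ht)
  -- Fubini on the triangle `s ≤ u`: the inner integral over `u` is `disc s - disc t`, the inner
  -- integral over `s` is the distribution function.
  have hset : MeasurableSet {p : ℝ × ℝ | p.1 ≤ p.2} :=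
    measurableSet_le measurable_fst measurable_snd
  have hint : Integrable (Function.uncurry fun s u : ℝ => if s ≤ u then D u else 0)
      ((F.law.restrict (Icc 0 t)).prod (volume.restrict (Ioc 0 t))) := by
    refine ((hDi.comp_snd (F.law.restrict (Icc 0 t))).indicator hset).congr
      (ae_of_all _ fun p => ?_)
    simp [indicator, Function.uncurry]
  have hswap := integral_integral_swap hint
  have hl : ∫ s in Icc 0 t, (∫ u in Ioc 0 t, (if s ≤ u then D u else 0)) ∂F.law
      = ∫ s in Icc 0 t, (M.disc s - M.disc t) ∂F.law := by
    refine setIntegral_congr_fun measurableSet_Icc fun s hs => ?_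
    rw [← M.integral_decay hs.1 ht, intervalIntegral.integral_of_le hs.2]
    have : (fun u => if s ≤ u then D u else 0) = (Ici s).indicator D := by
      ext u; simp [indicator]
    rw [this, setIntegral_indicator measurableSet_Ici]
    refine setIntegral_congr_set ?_
    have hn : ∀ᵐ x : ℝ, x ≠ s := by simp [ae_iff]
    filter_upwards [hn] with x hx
    refine propext ⟨fun h => ⟨lt_of_le_of_ne h.2 hx.symm, h.1.2⟩,
      fun h => ⟨⟨hs.1.trans_lt h.1, h.2⟩, h.1.le⟩⟩
  have hr : ∫ u in Ioc 0 t, ∫ s in Icc 0 t, (if s ≤ u then D u else 0) ∂F.law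
      = ∫ u in (0 : ℝ)..t, D u * F.cdf u := by
    rw [intervalIntegral.integral_of_le ht]
    refine setIntegral_congr_fun measurableSet_Ioc fun u hu => ?_
    have : (fun s => if s ≤ u then D u else 0) = (Iic u).indicator fun _ => D u := by
      ext s; simp [indicator]
    rw [this, setIntegral_indicator measurableSet_Iic, setIntegral_const, smul_eq_mul, mul_comm,
      ← F.law_real_Icc]
    congr 2
    ext x
    exact ⟨fun h => ⟨h.1.1, h.2⟩, fun h => ⟨⟨h.1, h.2.trans hu.2⟩, h.2⟩⟩
  rw [hl, hr, integral_sub (F.integrableOn_law M.disc_continuousOn t)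
    (integrable_const _), setIntegral_const, F.law_real_Icc, smul_eq_mul] at hswap
  linarith

end TimeStrategy

/-! ### Beliefs, and the principal's payoff as an integral of marginal values. -/

theorem tendsto_tsum_indicator_Iic {a : ℝ → ℝ} (ha : Summable a) :
    Tendsto (fun t : ℝ => ∑' s, (Iic t).indicator a s) atTop (𝓝 (∑' s, a s)) := by
  refine tendsto_tsum_of_dominated_convergence ha.norm (fun s => ?_) (.of_forall fun t s => ?_)
  · refine tendsto_const_nhds.congr' ?_
    filter_upwards [eventually_ge_atTop s] with t ht
    exact (indicator_of_mem (mem_Iic.2 ht) a).symm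
  · exact norm_indicator_le_norm_self _ _

namespace SearchGame

variable (M : SearchGame)

theorem intervalIntegrable_of_integrableOn {f : ℝ → ℝ} (hf : IntegrableOn f (Ioi 0)) {s t : ℝ}
    (hs : 0 ≤ s) (ht : 0 ≤ t) : IntervalIntegrable f volume s t := by
  rw [intervalIntegrable_iff]
  exact hf.mono_set fun x hx => (le_min hs ht).trans_lt hx.1

theorem exp_le_one {s : ℝ} (hs : 0 ≤ s) : Real.exp (-M.ρ * s) ≤ 1 := by
  rw [Real.exp_le_one_iff]
  have := mul_nonneg M.ρ_pos.le hs
  linarith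

theorem integrableOn_exp_mul_g : IntegrableOn (fun s => Real.exp (-M.ρ * s) * M.g s) (Ioi 0) := by
  refine Integrable.bdd_mul (c := 1) M.g_integrableOn (by fun_prop) ?_
  filter_upwards [ae_restrict_mem measurableSet_Ioi] with x hx
  rw [Real.norm_eq_abs, Real.abs_exp]
  exact M.exp_le_one (le_of_lt hx)

theorem integrableOn_density_mul_disc (F : TimeStrategy) :
    IntegrableOn (fun s => F.density s * M.disc s) (Ioi 0) := by
  refine Integrable.mul_bdd (c := 1) F.density_integrable.integrableOn
    ((M.disc_continuousOn.mono Ioi_subset_Ici_self).aestronglyMeasurable measurableSet_Ioi) ?_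
  filter_upwards [ae_restrict_mem measurableSet_Ioi] with x hx
  rw [Real.norm_eq_abs, abs_of_pos (M.disc_pos (le_of_lt hx))]
  exact M.disc_le_one (le_of_lt hx)

theorem summable_atom_mul_disc (F : TimeStrategy) :
    Summable fun s => F.atom s * M.disc s := by
  refine F.atom_summable.of_norm_bounded fun s => ?_
  rcases lt_or_ge s 0 with h | h
  · simp [F.atom_neg s h]
  · rw [Real.norm_eq_abs, abs_mul, abs_of_nonneg (F.atom_nonneg s), abs_of_pos (M.disc_pos h)]
    exact mul_le_of_le_one_right (F.atom_nonneg s) (M.disc_le_one h)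

/-- Probability that no fake news has arrived by `t`. -/
noncomputable def unfaked (F : TimeStrategy) (t : ℝ) : ℝ := 1 - M.σ * F.cdf t

theorem unfaked_ge (F : TimeStrategy) (t : ℝ) : 1 - M.σ ≤ M.unfaked F t := by
  have := mul_le_of_le_one_right M.σ_pos.le (F.cdf_le_one t)
  rw [unfaked]; linarith

theorem unfaked_pos (F : TimeStrategy) (t : ℝ) : 0 < M.unfaked F t :=
  (sub_pos.2 M.σ_lt_one).trans_le (M.unfaked_ge F t)

theorem unfaked_le_one (F : TimeStrategy) (t : ℝ) : M.unfaked F t ≤ 1 := by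
  have := mul_nonneg M.σ_pos.le (F.cdf_nonneg t)
  rw [unfaked]; linarith

theorem measurable_unfaked (F : TimeStrategy) : Measurable (M.unfaked F) :=
  (F.measurable_cdf.const_mul _).const_sub _

/-- Density of type-1 news times the gain from accepting it. -/
noncomputable def gain (F : TimeStrategy) (t : ℝ) : ℝ :=
  M.μ * (1 - M.θ) * M.g t * M.unfaked F t - (M.θ - M.μ) * (M.σ * F.density t * (1 - M.G t))

theorem sum_newsDensity_zero (F : TimeStrategy) (t : ℝ) :
    ∑ ω, M.newsDensity F ω 0 t = (1 - M.μ) * M.g t * M.unfaked F t := by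
  simp [newsDensity, prior, unfaked]; ring

theorem sum_newsDensity_one (F : TimeStrategy) (t : ℝ) :
    ∑ ω, M.newsDensity F ω 1 t
      = M.μ * M.g t * M.unfaked F t + M.σ * F.density t * (1 - M.G t) := by
  simp [Fin.sum_univ_two, newsDensity, prior, unfaked]; ring

theorem newsDensity_one_one (F : TimeStrategy) (t : ℝ) :
    M.newsDensity F 1 1 t
      = M.μ * (M.g t * M.unfaked F t + M.σ * F.density t * (1 - M.G t)) := by
  simp [newsDensity, prior, unfaked]

theorem sum_newsAtom_one (F : TimeStrategy) (t : ℝ) :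
    ∑ ω, M.newsAtom F ω 1 t = M.σ * F.atom t * (1 - M.G t) := by
  simp [Fin.sum_univ_two, newsAtom, prior]; ring

theorem posterior_of_atom_pos (F : TimeStrategy) {t : ℝ} (ht : 0 ≤ t) (h : 0 < F.atom t) :
    M.posterior F 1 t = M.μ := by
  have h1 : 0 < M.σ * F.atom t * (1 - M.G t) :=
    mul_pos (mul_pos M.σ_pos h) (M.one_sub_G_pos ht)
  rw [posterior, sum_newsAtom_one, if_pos h1]
  simp only [newsAtom, prior, if_true]
  exact mul_div_cancel_right₀ _ h1.ne'

theorem posterior_of_atom_eq_zero (F : TimeStrategy) {t : ℝ} (h : F.atom t = 0) :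
    M.posterior F 1 t = M.μ * (M.g t * M.unfaked F t + M.σ * F.density t * (1 - M.G t))
      / (M.μ * M.g t * M.unfaked F t + M.σ * F.density t * (1 - M.G t)) := by
  rw [posterior, sum_newsAtom_one, h, if_neg (by simp), newsDensity_one_one, sum_newsDensity_one]

theorem newsDensity_one_pos (F : TimeStrategy) {t : ℝ} (ht : 0 ≤ t) :
    0 < M.μ * M.g t * M.unfaked F t + M.σ * F.density t * (1 - M.G t) :=
  add_pos_of_pos_of_nonneg (mul_pos (mul_pos M.μ_pos (M.g_pos ht)) (M.unfaked_pos F t))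
    (mul_nonneg (mul_nonneg M.σ_pos.le (F.density_nonneg t)) (M.one_sub_G_pos ht).le)

/-- Bayes' rule with the denominator cleared: comparing the posterior with `θ` becomes the sign of
`gain`, which is affine in the fake-news density. -/
theorem newsDensity_mul_posterior_sub (F : TimeStrategy) {t : ℝ} (ht : 0 ≤ t)
    (h : F.atom t = 0) :
    (M.μ * M.g t * M.unfaked F t + M.σ * F.density t * (1 - M.G t))
      * (M.posterior F 1 t - M.θ) = M.gain F t := by
  rw [M.posterior_of_atom_eq_zero F h, mul_sub, mul_div_cancel₀ _ (M.newsDensity_one_pos F ht).ne',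
    gain]
  ring

theorem gain_nonpos_of_posterior_le (F : TimeStrategy) {t : ℝ} (ht : 0 ≤ t)
    (h : F.atom t = 0) (hp : M.posterior F 1 t ≤ M.θ) : M.gain F t ≤ 0 := by
  rw [← M.newsDensity_mul_posterior_sub F ht h]
  exact mul_nonpos_of_nonneg_of_nonpos (M.newsDensity_one_pos F ht).le (sub_nonpos.2 hp)

theorem posterior_eq_one_of_not_charges (F : TimeStrategy) {t : ℝ} (ht : 0 ≤ t)
    (h : ¬ F.Charges t) : M.posterior F 1 t = 1 := by
  rw [M.posterior_of_atom_eq_zero F (F.atom_eq_zero h), F.density_eq_zero h]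
  have := mul_pos (mul_pos M.μ_pos (M.g_pos ht)) (M.unfaked_pos F t)
  simp only [mul_zero, zero_mul, add_zero]
  rw [← mul_assoc, div_self this.ne']

/-- Optimal response to type-1 news. -/
structure ActOptimal (E : Profile) : Prop where
  act_eq_one : ∀ t, 0 ≤ t → M.θ < M.posterior E.faking 1 t → E.act t = 1
  act_eq_zero : ∀ t, 0 ≤ t → M.posterior E.faking 1 t < M.θ → E.act t = 0

theorem IsEquilibrium.actOptimal {M : SearchGame} {E : Profile} (h : M.IsEquilibrium E) :
    M.ActOptimal E := ⟨h.act_eq_one, h.act_eq_zero⟩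

/-- Derivative of the principal's payoff with respect to the stopping time. -/
noncomputable def marginP (E : Profile) (s : ℝ) : ℝ :=
  E.act s * (M.μ * (1 - M.θ) * (Real.exp (-M.ρ * s) * M.g s * M.unfaked E.faking s)
    - (M.θ - M.μ) * M.σ * (E.faking.density s * M.disc s))
    - M.ρ * M.θ * (M.disc s * M.unfaked E.faking s)

theorem marginP_eq (E : Profile) (s : ℝ) : M.marginP E s =
    Real.exp (-M.ρ * s) * (E.act s * M.gain E.faking s
      - M.ρ * M.θ * ((1 - M.G s) * M.unfaked E.faking s)) := by
  rw [marginP, gain, disc]; ring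

theorem flowP_eq (E : Profile) {s : ℝ} (hs : 0 ≤ s) (h : E.faking.atom s = 0) :
    M.flowP E s = M.θ * (Real.exp (-M.ρ * s) * M.g s * M.unfaked E.faking s)
      + M.θ * M.σ * (E.faking.density s * M.disc s)
      + E.act s * (M.μ * (1 - M.θ) * (Real.exp (-M.ρ * s) * M.g s * M.unfaked E.faking s)
    - (M.θ - M.μ) * M.σ * (E.faking.density s * M.disc s)) := by
  have h1 := M.newsDensity_mul_posterior_sub E.faking hs h
  rw [gain] at h1
  rw [flowP, sum_newsDensity_zero, sum_newsDensity_one, newsValue, disc]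
  linear_combination Real.exp (-M.ρ * s) * E.act s * h1

theorem integrableOn_exp_g_unfaked (F : TimeStrategy) :
    IntegrableOn (fun s => Real.exp (-M.ρ * s) * M.g s * M.unfaked F s) (Ioi 0) := by
  refine Integrable.mul_bdd (c := 1) M.integrableOn_exp_mul_g
    (M.measurable_unfaked F).aestronglyMeasurable (ae_of_all _ fun x => ?_)
  rw [Real.norm_eq_abs, abs_of_pos (M.unfaked_pos F x)]
  exact M.unfaked_le_one F x

theorem integrableOn_act_mul (E : Profile) {f : ℝ → ℝ} (hf : IntegrableOn f (Ioi 0)) :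
    IntegrableOn (fun s => E.act s * f s) (Ioi 0) := by
  refine Integrable.bdd_mul (c := 1) hf E.act_measurable.aestronglyMeasurable
    (ae_of_all _ fun x => ?_)
  rw [Real.norm_eq_abs, abs_of_nonneg (E.act_mem x).1]
  exact (E.act_mem x).2

theorem integrableOn_accept (E : Profile) : IntegrableOn (fun s =>
    E.act s * (M.μ * (1 - M.θ) * (Real.exp (-M.ρ * s) * M.g s * M.unfaked E.faking s)
    - (M.θ - M.μ) * M.σ * (E.faking.density s * M.disc s))) (Ioi 0) :=
  integrableOn_act_mul E (((M.integrableOn_exp_g_unfaked E.faking).const_mul _).sub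
    ((M.integrableOn_density_mul_disc E.faking).const_mul _))

theorem integrableOn_flowP (E : Profile) : IntegrableOn (M.flowP E) (Ioi 0) := by
  have h := (((M.integrableOn_exp_g_unfaked E.faking).const_mul M.θ).add
    ((M.integrableOn_density_mul_disc E.faking).const_mul (M.θ * M.σ))).add
    (M.integrableOn_accept E)
  refine Integrable.congr h ?_
  filter_upwards [ae_restrict_mem measurableSet_Ioi,
    ae_restrict_of_ae E.faking.ae_atom_eq_zero] with s hs h0
  rw [M.flowP_eq E (le_of_lt hs) h0]
  rfl

theorem intervalIntegrable_disc_unfaked (F : TimeStrategy) {s t : ℝ} (hs : 0 ≤ s) (ht : 0 ≤ t) :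
    IntervalIntegrable (fun x => M.disc x * M.unfaked F x) volume s t := by
  have hi := intervalIntegrable_of_continuousOn M.disc_continuousOn hs ht
  rw [intervalIntegrable_iff] at hi ⊢
  refine Integrable.mul_bdd (c := 1) hi
    (M.measurable_unfaked F).aestronglyMeasurable (ae_of_all _ fun x => ?_)
  rw [Real.norm_eq_abs, abs_of_pos (M.unfaked_pos F x)]
  exact M.unfaked_le_one F x

theorem intervalIntegrable_marginP (E : Profile) {s t : ℝ} (hs : 0 ≤ s) (ht : 0 ≤ t) :
    IntervalIntegrable (M.marginP E) volume s t :=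
  (intervalIntegrable_of_integrableOn (M.integrableOn_accept E) hs ht).sub
    ((M.intervalIntegrable_disc_unfaked E.faking hs ht).const_mul _)

theorem intervalIntegrable_decay_cdf (F : TimeStrategy) {s t : ℝ} (hs : 0 ≤ s) (ht : 0 ≤ t) :
    IntervalIntegrable (fun u => (M.ρ + M.hazard u) * M.disc u * F.cdf u) volume s t := by
  have hi := intervalIntegrable_of_continuousOn M.continuousOn_decay hs ht
  rw [intervalIntegrable_iff] at hi ⊢
  refine Integrable.mul_bdd (c := 1) hi F.measurable_cdf.aestronglyMeasurable
    (ae_of_all _ fun x => ?_)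
  rw [Real.norm_eq_abs, abs_of_nonneg (F.cdf_nonneg x)]
  exact F.cdf_le_one x

variable {M}

/-- News at an atom of faking has posterior `μ < θ`, so it is rejected and worth `θ`. -/
theorem ActOptimal.flowAtomP_eq {E : Profile} (hE : M.ActOptimal E) (s : ℝ) :
    M.flowAtomP E s = M.θ * M.σ * (E.faking.atom s * M.disc s) := by
  rw [flowAtomP, sum_newsAtom_one]
  rcases (E.faking.atom_nonneg s).eq_or_lt with h | h
  · rw [← h]; simp
  · have hs : 0 ≤ s := TimeStrategy.Charges.nonneg (Or.inr h)
    have hp := M.posterior_of_atom_pos E.faking hs h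
    rw [newsValue, hE.act_eq_zero s hs (by rw [hp]; exact M.μ_lt_θ), disc]
    ring

/-- Integrating `disc` by parts against the faking law, the drop of the survival probability at each
atom cancels the payoff `θ` from rejected news there. This is what makes `uP` continuous even if
faking has atoms. -/
theorem ActOptimal.uP_eq {E : Profile} (hE : M.ActOptimal E) {t : ℝ} (ht : 0 ≤ t) :
    M.uP E t = M.θ + ∫ s in (0 : ℝ)..t, M.marginP E s := by
  have e1 : ∫ s in (0 : ℝ)..t, M.flowP E s = ∫ s in (0 : ℝ)..t, (M.marginP E s
      + M.θ * ((M.ρ + M.hazard s) * M.disc s)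
      - M.θ * M.σ * ((M.ρ + M.hazard s) * M.disc s * E.faking.cdf s)
      + M.θ * M.σ * (E.faking.density s * M.disc s)) := by
    refine intervalIntegral.integral_congr_ae ?_
    filter_upwards [E.faking.ae_atom_eq_zero] with s h0 hs
    rw [uIoc_of_le ht] at hs
    rw [M.flowP_eq E hs.1.le h0, marginP, M.exp_mul_g_eq hs.1.le, unfaked]
    ring
  have i1 := M.intervalIntegrable_marginP E le_rfl ht
  have i2 := (intervalIntegrable_of_continuousOn M.continuousOn_decay le_rfl ht).const_mul M.θ
  have i3 := (M.intervalIntegrable_decay_cdf E.faking le_rfl ht).const_mul (M.θ * M.σ)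
  have i4 := (intervalIntegrable_of_integrableOn
    (M.integrableOn_density_mul_disc E.faking) le_rfl ht).const_mul (M.θ * M.σ)
  rw [intervalIntegral.integral_add ((i1.add i2).sub i3) i4,
    intervalIntegral.integral_sub (i1.add i2) i3, intervalIntegral.integral_add i1 i2] at e1
  simp only [intervalIntegral.integral_const_mul] at e1
  rw [M.integral_decay le_rfl ht, disc_zero] at e1
  have e2 : ∑' s, (Iic t).indicator (M.flowAtomP E) s = M.θ * M.σ *
      ∑' s, (Iic t).indicator (fun s => E.faking.atom s * M.disc s) s := by
    rw [← tsum_mul_left]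
    refine tsum_congr fun s => ?_
    by_cases hs : s ∈ Iic t
    · simp only [indicator_of_mem hs, hE.flowAtomP_eq]
    · simp only [indicator_of_notMem hs, mul_zero]
  have e3 := E.faking.setIntegral_law_Icc M.disc_continuousOn ht
  rw [E.faking.setIntegral_disc M ht] at e3
  have e4 : Real.exp (-M.ρ * t) * ((1 - M.G t) * (1 - M.σ * E.faking.cdf t)) * M.θ
      = M.disc t * (1 - M.σ * E.faking.cdf t) * M.θ := by rw [disc]; ring
  rw [uP, e1, e2, e4]
  linear_combination -M.θ * M.σ * e3

theorem ActOptimal.uP_zero {E : Profile} (hE : M.ActOptimal E) : M.uP E 0 = M.θ := by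
  rw [hE.uP_eq le_rfl, intervalIntegral.integral_same, add_zero]

theorem ActOptimal.uP_sub {E : Profile} (hE : M.ActOptimal E) {s t : ℝ} (hs : 0 ≤ s)
    (ht : 0 ≤ t) : M.uP E t - M.uP E s = ∫ x in s..t, M.marginP E x := by
  rw [hE.uP_eq ht, hE.uP_eq hs, add_sub_add_left_eq_sub, intervalIntegral.integral_interval_sub_left
    (M.intervalIntegrable_marginP E le_rfl ht) (M.intervalIntegrable_marginP E le_rfl hs)]

theorem ActOptimal.uP_continuousOn {E : Profile} (hE : M.ActOptimal E) :
    ContinuousOn (M.uP E) (Ici 0) := by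
  intro t ht
  have h1 : ContinuousOn (fun x => M.θ + ∫ s in (0 : ℝ)..x, M.marginP E s) (Icc 0 (t + 1)) := by
    have := intervalIntegral.continuousOn_primitive_interval' (a := 0)
      (M.intervalIntegrable_marginP E le_rfl (by linarith [mem_Ici.1 ht] : 0 ≤ t + 1)) left_mem_uIcc
    rw [uIcc_of_le (by linarith [mem_Ici.1 ht])] at this
    exact continuousOn_const.add this
  have h2 : ContinuousOn (M.uP E) (Icc 0 (t + 1)) := h1.congr fun x hx => hE.uP_eq hx.1
  refine (h2 t ⟨ht, by linarith⟩).mono_of_mem_nhdsWithin ?_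
  rw [← Ici_inter_Iic]
  exact inter_mem self_mem_nhdsWithin (mem_nhdsWithin_of_mem_nhds (Iic_mem_nhds (by linarith)))

theorem ActOptimal.tendsto_uP {E : Profile} (hE : M.ActOptimal E) :
    Tendsto (M.uP E) atTop (𝓝 (M.uPNever E)) := by
  have h1 := intervalIntegral_tendsto_integral_Ioi 0 (M.integrableOn_flowP E) tendsto_id
  have hs : Summable (M.flowAtomP E) := by
    rw [show M.flowAtomP E = fun s => _ from funext hE.flowAtomP_eq]
    exact (M.summable_atom_mul_disc E.faking).mul_left _
  have h2 := tendsto_tsum_indicator_Iic hs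
  have h3 : Tendsto (fun t => Real.exp (-M.ρ * t) * ((1 - M.G t) * (1 - M.σ * E.faking.cdf t))
      * M.θ) atTop (𝓝 0) := by
    refine squeeze_zero' (g := M.disc) ?_ ?_ M.tendsto_disc
    · filter_upwards [eventually_ge_atTop 0] with t ht
      exact mul_nonneg (mul_nonneg (Real.exp_pos _).le (mul_nonneg (M.one_sub_G_pos ht).le
        (M.unfaked_pos _ t).le)) M.θ_pos.le
    · filter_upwards [eventually_ge_atTop 0] with t ht
      have e : Real.exp (-M.ρ * t) * ((1 - M.G t) * (1 - M.σ * E.faking.cdf t)) * M.θ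
        = M.disc t * (M.unfaked E.faking t * M.θ) := by rw [disc, unfaked]; ring
      rw [e]
      exact mul_le_of_le_one_right (M.disc_pos ht).le
        (mul_le_one₀ (M.unfaked_le_one _ t) M.θ_pos.le M.θ_lt_one.le)
  have := (h1.add h2).add h3
  rw [add_zero] at this
  exact this

end SearchGame

/-! ### The agent's payoff as an integral plus an acceptance premium. -/

namespace SearchGame

variable (M : SearchGame)

/-- Derivative, up to the value of current acceptance, of the agent's payoff with respect to the
faking time. -/
noncomputable def marginA (E : Profile) (s : ℝ) : ℝ :=
  (1 - E.stopping.cdf s) * (M.disc s * (M.hazard s * M.μ * (1 - M.β) * E.act s - M.β * M.ρ))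

theorem flowA_eq (E : Profile) {s : ℝ} (hs : 0 ≤ s) :
    M.flowA E s = M.marginA E s + M.β * ((M.ρ + M.hazard s) * M.disc s)
      - M.β * ((M.ρ + M.hazard s) * M.disc s * E.stopping.cdf s)
      + M.β * (E.stopping.density s * M.disc s) := by
  have h1 := M.exp_mul_g_eq hs
  have h2 : M.disc s = Real.exp (-M.ρ * s) * (1 - M.G s) := rfl
  rw [flowA, marginA]
  linear_combination (1 - E.stopping.cdf s) * (M.β + M.μ * (1 - M.β) * E.act s) * h1
    - E.stopping.density s * M.β * h2

theorem intervalIntegrable_marginA (E : Profile) {s t : ℝ} (hs : 0 ≤ s) (ht : 0 ≤ t) :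
    IntervalIntegrable (M.marginA E) volume s t := by
  have h1 := intervalIntegrable_of_continuousOn
    (M.disc_continuousOn.mul (M.hazard_continuousOn.mul_const (M.μ * (1 - M.β)))) hs ht
  have h2 := (intervalIntegrable_of_continuousOn M.disc_continuousOn hs ht).mul_const (M.β * M.ρ)
  rw [intervalIntegrable_iff] at h1 h2 ⊢
  have h3 : IntegrableOn (fun x => E.act x * (M.disc x * (M.hazard x * (M.μ * (1 - M.β)))))
      (uIoc s t) := by
    refine Integrable.bdd_mul (c := 1) h1 E.act_measurable.aestronglyMeasurable
      (ae_of_all _ fun x => ?_)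
    rw [Real.norm_eq_abs, abs_of_nonneg (E.act_mem x).1]
    exact (E.act_mem x).2
  have h4 : IntegrableOn (fun x => (1 - E.stopping.cdf x) *
      (E.act x * (M.disc x * (M.hazard x * (M.μ * (1 - M.β)))) - M.disc x * (M.β * M.ρ)))
      (uIoc s t) := by
    refine Integrable.bdd_mul (c := 1) (h3.sub h2)
      (E.stopping.measurable_cdf.const_sub 1).aestronglyMeasurable
      (ae_of_all _ fun x => ?_)
    rw [Real.norm_eq_abs, abs_of_nonneg (sub_nonneg.2 (E.stopping.cdf_le_one x))]
    linarith [E.stopping.cdf_nonneg x]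
  refine h4.congr (ae_of_all _ fun x => ?_)
  simp only [marginA]; ring

theorem flowAtomA_eq (E : Profile) (s : ℝ) :
    M.flowAtomA E s = M.β * (E.stopping.atom s * M.disc s) := by
  rw [flowAtomA, disc]; ring

/-- Being stopped yields `β`, the same as rejected fake news, so atoms of stopping cancel after
integration by parts. Discontinuities in `t` remain only in the last term, through the acceptance
probability and the stopping distribution. -/
theorem uA_eq (E : Profile) {t : ℝ} (ht : 0 ≤ t) :
    M.uA E t = M.β + (∫ s in (0 : ℝ)..t, M.marginA E s)
      + M.disc t * (1 - E.stopping.cdf t) * (M.μ - M.β) * E.act t := by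
  have e1 : ∫ s in (0 : ℝ)..t, M.flowA E s = ∫ s in (0 : ℝ)..t, (M.marginA E s
      + M.β * ((M.ρ + M.hazard s) * M.disc s)
      - M.β * ((M.ρ + M.hazard s) * M.disc s * E.stopping.cdf s)
      + M.β * (E.stopping.density s * M.disc s)) :=
    intervalIntegral.integral_congr fun s hs => M.flowA_eq E (uIcc_subset_Ici le_rfl ht hs)
  have i1 := M.intervalIntegrable_marginA E le_rfl ht
  have i2 := (intervalIntegrable_of_continuousOn M.continuousOn_decay le_rfl ht).const_mul M.β
  have i3 := (M.intervalIntegrable_decay_cdf E.stopping le_rfl ht).const_mul M.β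
  have i4 := (intervalIntegrable_of_integrableOn
    (M.integrableOn_density_mul_disc E.stopping) le_rfl ht).const_mul M.β
  rw [intervalIntegral.integral_add ((i1.add i2).sub i3) i4,
    intervalIntegral.integral_sub (i1.add i2) i3, intervalIntegral.integral_add i1 i2] at e1
  simp only [intervalIntegral.integral_const_mul] at e1
  rw [M.integral_decay le_rfl ht, disc_zero] at e1
  have e2 : ∑' s, (Iic t).indicator (M.flowAtomA E) s = M.β *
      ∑' s, (Iic t).indicator (fun s => E.stopping.atom s * M.disc s) s := by
    rw [← tsum_mul_left]
    refine tsum_congr fun s => ?_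
    by_cases hs : s ∈ Iic t
    · simp only [indicator_of_mem hs, flowAtomA_eq]
    · simp only [indicator_of_notMem hs, mul_zero]
  have e3 := E.stopping.setIntegral_law_Icc M.disc_continuousOn ht
  rw [E.stopping.setIntegral_disc M ht] at e3
  have e4 : Real.exp (-M.ρ * t) * ((1 - M.G t) * (1 - E.stopping.cdf t))
      = M.disc t * (1 - E.stopping.cdf t) := by rw [disc]; ring
  rw [uA, e1, e2, e4]
  linear_combination -M.β * e3

theorem integrableOn_flowA (E : Profile) : IntegrableOn (M.flowA E) (Ioi 0) := by
  have h1 : IntegrableOn (fun s => E.act s * (Real.exp (-M.ρ * s) * M.g s)) (Ioi 0) :=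
    integrableOn_act_mul E M.integrableOn_exp_mul_g
  have h2 : IntegrableOn (fun s => (1 - E.stopping.cdf s) *
      (M.β * (Real.exp (-M.ρ * s) * M.g s)
        + M.μ * (1 - M.β) * (E.act s * (Real.exp (-M.ρ * s) * M.g s)))) (Ioi 0) := by
    refine Integrable.bdd_mul (c := 1)
      ((M.integrableOn_exp_mul_g.const_mul _).add (h1.const_mul _))
      (E.stopping.measurable_cdf.const_sub 1).aestronglyMeasurable (ae_of_all _ fun x => ?_)
    rw [Real.norm_eq_abs, abs_of_nonneg (sub_nonneg.2 (E.stopping.cdf_le_one x))]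
    linarith [E.stopping.cdf_nonneg x]
  refine (h2.add ((M.integrableOn_density_mul_disc E.stopping).const_mul M.β)).congr
    (ae_of_all _ fun s => ?_)
  simp only [Pi.add_apply, flowA, disc]; ring

theorem tendsto_uA (E : Profile) : Tendsto (M.uA E) atTop (𝓝 (M.uANever E)) := by
  have h1 := intervalIntegral_tendsto_integral_Ioi 0 (M.integrableOn_flowA E) tendsto_id
  have hs : Summable (M.flowAtomA E) := by
    rw [show M.flowAtomA E = fun s => _ from funext (M.flowAtomA_eq E)]
    exact (M.summable_atom_mul_disc E.stopping).mul_left _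
  have h2 := tendsto_tsum_indicator_Iic hs
  have h3 : Tendsto (fun t => Real.exp (-M.ρ * t) * ((1 - M.G t) * (1 - E.stopping.cdf t))
      * ((1 - E.act t) * M.β + M.μ * E.act t)) atTop (𝓝 0) := by
    have hβ := M.β_pos
    have hμ := M.μ_pos
    have hβ1 := M.β_lt_one
    have hμ1 := M.μ_lt_one
    refine squeeze_zero' (g := M.disc) ?_ ?_ M.tendsto_disc
    · filter_upwards [eventually_ge_atTop 0] with t ht
      obtain ⟨ha0, ha1⟩ := E.act_mem t
      have := sub_nonneg.2 (E.stopping.cdf_le_one t)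
      have := M.one_sub_G_pos ht
      have := sub_nonneg.2 ha1
      positivity
    · filter_upwards [eventually_ge_atTop 0] with t ht
      obtain ⟨ha0, ha1⟩ := E.act_mem t
      have h0 := sub_nonneg.2 ha1
      have e : Real.exp (-M.ρ * t) * ((1 - M.G t) * (1 - E.stopping.cdf t))
        * ((1 - E.act t) * M.β + M.μ * E.act t) = M.disc t * ((1 - E.stopping.cdf t) *
          ((1 - E.act t) * M.β + M.μ * E.act t)) := by rw [disc]; ring
      rw [e]
      refine mul_le_of_le_one_right (M.disc_pos ht).le (mul_le_one₀ ?_ (by positivity) ?_)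
      · linarith [E.stopping.cdf_nonneg t]
      · nlinarith
  have := (h1.add h2).add h3
  rw [add_zero] at this
  exact this

end SearchGame

/-! ### Principal's best replies. -/

namespace SearchGame

variable {M : SearchGame} {E : Profile}

/-- Fakes and rejections can only lower the marginal value of search below that of accepting pure
real news. The bound is attained where nothing is faked, see `ActOptimal.marginP_of_not_charges`. -/
theorem marginP_le (E : Profile) {s : ℝ} (hs : 0 ≤ s) : M.marginP E s ≤
    M.disc s * M.unfaked E.faking s * (M.μ * (1 - M.θ) * (M.hazard s - M.φP)) := by
  obtain ⟨ha0, ha1⟩ := E.act_mem s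
  have h1 := M.exp_mul_g_eq hs
  have hL := M.unfaked_pos E.faking s
  have hd := M.disc_pos hs
  have hf := mul_nonneg (E.faking.density_nonneg s) hd.le
  have hk := mul_nonneg ha0 (mul_nonneg (mul_nonneg (sub_pos.2 M.μ_lt_θ).le M.σ_pos.le) hf)
  have hg := mul_nonneg (mul_nonneg M.μ_pos.le (sub_pos.2 M.θ_lt_one).le)
    (mul_nonneg (mul_nonneg (M.hazard_nonneg hs) hd.le) hL.le)
  have ha := mul_le_of_le_one_left hg ha1
  have e : M.disc s * M.unfaked E.faking s * (M.μ * (1 - M.θ) * (M.hazard s - M.φP))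
      = M.μ * (1 - M.θ) * (M.hazard s * M.disc s * M.unfaked E.faking s)
        - M.disc s * M.unfaked E.faking s * (M.ρ * M.θ) := by
    rw [← M.φP_mul]; ring
  rw [e, marginP, h1]
  linarith

theorem ActOptimal.posterior_le_of_act_ne_one (hE : M.ActOptimal E) {s : ℝ} (hs : 0 ≤ s)
    (h : E.act s ≠ 1) : M.posterior E.faking 1 s ≤ M.θ :=
  not_lt.1 fun h' => h (hE.act_eq_one s hs h')

/-- Without fakes the posterior is `1 > θ`. So any time at which news is not surely accepted is a
charged faking time, hence in equilibrium a best time to fake. -/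
theorem ActOptimal.charges_of_act_ne_one (hE : M.ActOptimal E) {s : ℝ} (hs : 0 ≤ s)
    (h : E.act s ≠ 1) : E.faking.Charges s := by
  by_contra hc
  have := hE.posterior_le_of_act_ne_one hs h
  rw [M.posterior_eq_one_of_not_charges E.faking hs hc] at this
  exact absurd M.θ_lt_one (not_lt.2 this)

theorem ActOptimal.marginP_of_not_charges (hE : M.ActOptimal E) {s : ℝ} (hs : 0 ≤ s)
    (h : ¬ E.faking.Charges s) : M.marginP E s =
    M.disc s * M.unfaked E.faking s * (M.μ * (1 - M.θ) * (M.hazard s - M.φP)) := by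
  have ha : E.act s = 1 := by
    by_contra h'
    exact h (hE.charges_of_act_ne_one hs h')
  have e : M.disc s * M.unfaked E.faking s * (M.μ * (1 - M.θ) * (M.hazard s - M.φP))
      = M.μ * (1 - M.θ) * (M.hazard s * M.disc s * M.unfaked E.faking s)
        - M.disc s * M.unfaked E.faking s * (M.ρ * M.θ) := by
    rw [← M.φP_mul]; ring
  rw [e, marginP, M.exp_mul_g_eq hs, E.faking.density_eq_zero h, ha]
  ring

/-- Stopping is strictly better than searching while type-1 news is not surely accepted. -/
theorem ActOptimal.uP_lt_of_act_ne_one (hE : M.ActOptimal E) {x c : ℝ} (hx : 0 ≤ x)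
    (hxc : x < c) (h : ∀ s ∈ Ioo x c, E.act s ≠ 1) : M.uP E c < M.uP E x := by
  have hc : 0 ≤ c := hx.trans hxc.le
  have i1 := M.intervalIntegrable_marginP E hx hc
  have i2 := (M.intervalIntegrable_disc_unfaked E.faking hx hc).const_mul (-(M.ρ * M.θ))
  have h1 : ∫ s in x..c, M.marginP E s
      ≤ ∫ s in x..c, -(M.ρ * M.θ) * (M.disc s * M.unfaked E.faking s) := by
    refine intervalIntegral.integral_mono_ae_restrict hxc.le i1 i2 ?_
    have hne : ∀ y : ℝ, ∀ᵐ s : ℝ, s ≠ y := fun y => by simp [ae_iff]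
    filter_upwards [ae_restrict_mem measurableSet_Icc,
      ae_restrict_of_ae E.faking.ae_atom_eq_zero, ae_restrict_of_ae (hne x),
      ae_restrict_of_ae (hne c)] with s hs h0 hsx hsc
    have hs0 : 0 ≤ s := hx.trans hs.1
    have hg := M.gain_nonpos_of_posterior_le E.faking hs0 h0 (hE.posterior_le_of_act_ne_one hs0
      (h s ⟨lt_of_le_of_ne hs.1 hsx.symm, lt_of_le_of_ne hs.2 hsc⟩))
    have hag := mul_nonneg (Real.exp_pos (-M.ρ * s)).le
      (mul_nonneg (E.act_mem s).1 (neg_nonneg.2 hg))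
    rw [marginP_eq, disc]
    linarith
  have h2 := intervalIntegral.intervalIntegral_pos_of_pos_on
    (M.intervalIntegrable_disc_unfaked E.faking hx hc)
    (fun s hs => mul_pos (M.disc_pos (hx.trans hs.1.le)) (M.unfaked_pos _ s)) hxc
  have h3 := mul_pos (mul_pos M.ρ_pos M.θ_pos) h2
  rw [intervalIntegral.integral_const_mul, ← hE.uP_sub hx hc] at h1
  linarith

theorem ActOptimal.uP_lt_of_hazard_le (hE : M.ActOptimal E) {τ x t : ℝ} (hτ0 : 0 < τ)
    (hτ : M.hazard τ = M.φP) (hx : τ ≤ x) (hxt : x < t) : M.uP E t < M.uP E x := by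
  have hx0 : 0 ≤ x := hτ0.le.trans hx
  have ht0 : 0 ≤ t := hx0.trans hxt.le
  have h1 := intervalIntegral.intervalIntegral_pos_of_pos_on
    (M.intervalIntegrable_marginP E hx0 ht0).neg (fun s hs => ?_) hxt
  · change 0 < ∫ s in x..t, -(M.marginP E s) at h1
    rw [intervalIntegral.integral_neg, ← hE.uP_sub hx0 ht0] at h1
    linarith
  · have hs0 : 0 ≤ s := hx0.trans hs.1.le
    have h2 := M.hazard_lt hτ0.le (hx.trans_lt hs.1)
    rw [hτ] at h2
    have h3 := mul_pos (mul_pos (M.disc_pos hs0) (M.unfaked_pos E.faking s))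
      (mul_pos (mul_pos M.μ_pos (sub_pos.2 M.θ_lt_one)) (sub_pos.2 h2))
    have h4 := marginP_le (M := M) E hs0
    change 0 < -M.marginP E s
    linarith

theorem ActOptimal.uP_lt_of_not_charges (hE : M.ActOptimal E) {τ x t : ℝ}
    (hτ : M.hazard τ = M.φP) (hx : 0 ≤ x) (hxt : x < t) (ht : t ≤ τ)
    (h : ∀ s ∈ Ioo x t, ¬ E.faking.Charges s) : M.uP E x < M.uP E t := by
  have ht0 : 0 ≤ t := hx.trans hxt.le
  have h1 := intervalIntegral.intervalIntegral_pos_of_pos_on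
    (M.intervalIntegrable_marginP E hx ht0) (fun s hs => ?_) hxt
  · rw [← hE.uP_sub hx ht0] at h1
    linarith
  · have hs0 : 0 ≤ s := hx.trans hs.1.le
    have h2 := M.hazard_lt hs0 (hs.2.trans_le ht)
    rw [hτ] at h2
    rw [hE.marginP_of_not_charges hs0 (h s hs)]
    exact mul_pos (mul_pos (M.disc_pos hs0) (M.unfaked_pos E.faking s))
      (mul_pos (mul_pos M.μ_pos (sub_pos.2 M.θ_lt_one)) (sub_pos.2 h2))

/-- The equilibrium payoff is an average of `uP` and `uPNever` under a probability law, so it cannot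
exceed `θ` if none of these values does. -/
theorem exists_uP_gt_of_beneficialSearch (hB : M.BeneficialSearch E) :
    (∃ t, 0 ≤ t ∧ M.θ < M.uP E t) ∨ M.θ < M.uPNever E := by
  by_contra! hcon
  obtain ⟨h1, h2⟩ := hcon
  have hn : 0 ≤ E.stopping.never := by
    rw [E.stopping.never_eq]; linarith [E.stopping.law_real_univ_le_one]
  have hθ := M.θ_pos.le
  have hd0 := E.stopping.density_integrable.integrableOn (s := Ioi 0)
  have a1 : ∫ t in Ioi (0 : ℝ), M.uP E t * E.stopping.density t
      ≤ ∫ t in Ioi (0 : ℝ), M.θ * E.stopping.density t := by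
    by_cases hi : IntegrableOn (fun t => M.uP E t * E.stopping.density t) (Ioi 0)
    · exact setIntegral_mono_on hi (hd0.const_mul _) measurableSet_Ioi fun t ht =>
        mul_le_mul_of_nonneg_right (h1 t (le_of_lt ht)) (E.stopping.density_nonneg t)
    -- A non-integrable integrand gives the default value `0`, which is still below the nonnegative
    -- right-hand side; the non-summable case below is treated alike.
    · rw [integral_undef hi]
      exact setIntegral_nonneg measurableSet_Ioi fun t _ =>
        mul_nonneg hθ (E.stopping.density_nonneg t)
  have a2 : ∑' t, E.stopping.atom t * M.uP E t ≤ ∑' t, E.stopping.atom t * M.θ := by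
    by_cases hs : Summable fun t => E.stopping.atom t * M.uP E t
    · refine hs.tsum_le_tsum (fun t => ?_) (E.stopping.atom_summable.mul_right _)
      rcases lt_or_ge t 0 with ht | ht
      · simp [E.stopping.atom_neg t ht]
      · exact mul_le_mul_of_nonneg_left (h1 t ht) (E.stopping.atom_nonneg t)
    · rw [tsum_eq_zero_of_not_summable hs]
      exact tsum_nonneg fun t => mul_nonneg (E.stopping.atom_nonneg t) hθ
  have a3 := mul_le_mul_of_nonneg_left h2 hn
  have a4 : ∫ t in Ioi (0 : ℝ), E.stopping.density t ≤ ∫ t, E.stopping.density t :=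
    setIntegral_le_integral E.stopping.density_integrable
      (ae_of_all _ E.stopping.density_nonneg)
  have a5 := mul_le_mul_of_nonneg_left a4 hθ
  rw [integral_const_mul] at a1
  rw [tsum_mul_right] at a2
  have a6 : E.stopping.never * M.θ = M.θ - ((∫ t, E.stopping.density t) * M.θ
    + (∑' t, E.stopping.atom t) * M.θ) := by rw [TimeStrategy.never]; ring
  have hB' : M.θ < M.payoffP E := hB
  rw [payoffP] at hB'
  linarith

theorem IsEquilibrium.exists_uP_gt (hE : M.IsEquilibrium E) (hB : M.BeneficialSearch E) :
    ∃ t, 0 ≤ t ∧ M.θ < M.uP E t := by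
  rcases exists_uP_gt_of_beneficialSearch hB with h | h
  · exact h
  · obtain ⟨t, ht, ht0⟩ := ((hE.actOptimal.tendsto_uP.eventually_const_lt h).and
      (eventually_ge_atTop 0)).exists
    exact ⟨t, ht0, ht⟩

theorem IsEquilibrium.stopping_never (hE : M.IsEquilibrium E) {τ : ℝ} (hτ0 : 0 < τ)
    (hτ : M.hazard τ = M.φP) : E.stopping.never = 0 := by
  have hn : 0 ≤ E.stopping.never := by
    rw [E.stopping.never_eq]; linarith [E.stopping.law_real_univ_le_one]
  refine le_antisymm (not_lt.1 fun hpos => ?_) hn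
  have h1 := hE.stopping_optimal.2 hpos τ hτ0.le
  have h2 : M.uPNever E ≤ M.uP E (τ + 1) := by
    refine le_of_tendsto hE.actOptimal.tendsto_uP ?_
    filter_upwards [eventually_gt_atTop (τ + 1)] with t ht
    exact (hE.actOptimal.uP_lt_of_hazard_le hτ0 hτ (by linarith) ht).le
  have h3 := hE.actOptimal.uP_lt_of_hazard_le hτ0 hτ le_rfl (lt_add_one τ)
  linarith

theorem nonneg_of_mem_support (F : TimeStrategy) {t : ℝ}
    (ht : t ∈ F.law.support) : 0 ≤ t := by
  by_contra! h
  obtain ⟨s, hs, hc⟩ := F.exists_charges_near ht (neg_pos.2 h)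
  have := hc.nonneg
  linarith [hs.2]

/-- Charged times accumulate at every support point, and optimality passes to the limit by
continuity of `uP`. -/
theorem IsEquilibrium.isMaxOn_uP (hE : M.IsEquilibrium E) {t : ℝ}
    (ht : t ∈ E.stopping.law.support) : IsMaxOn (M.uP E) (Ici 0) t := by
  have ht0 := nonneg_of_mem_support _ ht
  intro t' ht'
  by_contra hlt
  have hev := (hE.actOptimal.uP_continuousOn t ht0).eventually_lt_const (not_le.1 hlt)
  obtain ⟨ε, hε, hev⟩ := Metric.nhdsWithin_basis_ball.eventually_iff.1 hev
  obtain ⟨s, hs, hc⟩ := E.stopping.exists_charges_near ht hε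
  have h1 := hev ⟨by rw [Metric.mem_ball, Real.dist_eq, abs_lt]; constructor <;>
    linarith [hs.1, hs.2], hc.nonneg⟩
  have h2 := (hE.stopping_optimal.1 s hc.nonneg hc).1 t' ht'
  linarith

theorem ActOptimal.exists_act_eq_one (hE : M.ActOptimal E) {x c : ℝ} (hx : 0 ≤ x)
    (hxc : x < c) (hc : IsMaxOn (M.uP E) (Ici 0) c) : ∃ s ∈ Ioo x c, E.act s = 1 := by
  by_contra! h
  exact absurd (hE.uP_lt_of_act_ne_one hx hxc h) (not_lt.2 (hc hx))

end SearchGame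

/-! ### Agent's best replies. -/

namespace SearchGame

variable {M : SearchGame} {E : Profile}

/-- While type-1 news is accepted with probability close to `1`, waiting beats faking. -/
theorem exists_waiting_better (hA2 : M.A2) {τ : ℝ} (hτ : M.hazard τ = M.φP) :
    ∃ η, 0 < η ∧ η < 1 ∧ ∀ w, 0 ≤ w → w ≤ τ → ∀ a, 1 - η ≤ a →
      (M.μ - M.β) * (M.ρ + M.hazard w) < M.hazard w * M.μ * (1 - M.β) * a - M.β * M.ρ := by
  -- At `a = 1` the inequality reads `ρ * μ < hazard w * β * (1 - μ)`, that is, `φA < hazard w`.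
  -- Since `φP ≤ hazard w` up to `τ`, `d` is a uniform slack; `η` is chosen so that accepting with
  -- probability `1 - η` uses at most half of it.
  set d := M.φP * (M.β * (1 - M.μ)) - M.ρ * M.μ with hd
  have hβμ : 0 < M.β * (1 - M.μ) := mul_pos M.β_pos (sub_pos.2 M.μ_lt_one)
  have hd0 : 0 < d := by
    have h1 := mul_lt_mul_of_pos_left hA2 hβμ
    rw [M.φA_mul] at h1
    rw [hd]; linarith
  have hh0 := M.hazard_pos le_rfl
  refine ⟨min (d / (2 * M.hazard 0)) (1 / 2), by positivity,
    (min_le_right _ _).trans_lt (by norm_num), fun w hw hwτ a ha => ?_⟩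
  have hh := M.hazard_pos hw
  have h1 : M.φP ≤ M.hazard w := hτ ▸ M.hazard_le hw hwτ
  have h2 : M.hazard w ≤ M.hazard 0 := M.hazard_le le_rfl hw
  have h3 : M.hazard w * (1 - a) ≤ d / 2 := by
    have h4 : 1 - a ≤ d / (2 * M.hazard 0) := by
      have := min_le_left (d / (2 * M.hazard 0)) (1 / 2)
      linarith
    calc M.hazard w * (1 - a) ≤ M.hazard w * (d / (2 * M.hazard 0)) :=
          mul_le_mul_of_nonneg_left h4 hh.le
      _ ≤ M.hazard 0 * (d / (2 * M.hazard 0)) := mul_le_mul_of_nonneg_right h2 (by positivity)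
      _ = d / 2 := by field_simp
  have hc0 : 0 < M.μ * (1 - M.β) := mul_pos M.μ_pos (sub_pos.2 M.β_lt_one)
  have hc1 : M.μ * (1 - M.β) ≤ 1 := mul_le_one₀ M.μ_lt_one.le (sub_pos.2 M.β_lt_one).le
    (by linarith [M.β_pos])
  have h5 : M.μ * (1 - M.β) * (M.hazard w * (1 - a)) ≤ d / 2 :=
    (mul_le_mul_of_nonneg_left h3 hc0.le).trans (mul_le_of_le_one_left (by positivity) hc1)
  have h6 := mul_le_mul_of_nonneg_right h1 hβμ.le
  have e : M.hazard w * M.μ * (1 - M.β) * a - M.β * M.ρ - (M.μ - M.β) * (M.ρ + M.hazard w)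
      = M.hazard w * (M.β * (1 - M.μ)) - M.ρ * M.μ
        - M.μ * (1 - M.β) * (M.hazard w * (1 - a)) := by ring
  linarith

theorem continuousOn_integral_marginA (M : SearchGame) (E : Profile) :
    ContinuousOn (fun x => ∫ s in (0 : ℝ)..x, M.marginA E s) (Ici 0) := by
  intro t ht
  have h0 : (0 : ℝ) ≤ t + 1 := by linarith [mem_Ici.1 ht]
  have h2 := intervalIntegral.continuousOn_primitive_interval' (a := 0)
    (M.intervalIntegrable_marginA E le_rfl h0) left_mem_uIcc
  rw [uIcc_of_le h0] at h2
  refine (h2 t ⟨ht, by linarith⟩).mono_of_mem_nhdsWithin ?_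
  rw [← Ici_inter_Iic]
  exact inter_mem self_mem_nhdsWithin (mem_nhdsWithin_of_mem_nhds (Iic_mem_nhds (by linarith)))

theorem integral_marginA_sub (M : SearchGame) (E : Profile) {s t : ℝ} (hs : 0 ≤ s) (ht : 0 ≤ t) :
    (∫ x in (0 : ℝ)..t, M.marginA E x) - (∫ x in (0 : ℝ)..s, M.marginA E x)
      = ∫ x in s..t, M.marginA E x :=
  intervalIntegral.integral_interval_sub_left
    (M.intervalIntegrable_marginA E le_rfl ht) (M.intervalIntegrable_marginA E le_rfl hs)

theorem IsEquilibrium.uA_le_of_charges (hE : M.IsEquilibrium E) {t t' : ℝ}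
    (ht : E.faking.Charges t) (ht' : 0 ≤ t') : M.uA E t' ≤ M.uA E t :=
  (hE.faking_optimal.1 t ht.nonneg ht).1 t' ht'

/-- On an interval on which the principal does not stop, the gain from waiting is positive if
type-1 news is accepted with probability close to `1`. -/
theorem waiting_gain {η τ b c k : ℝ} (hη : ∀ w, 0 ≤ w → w ≤ τ → ∀ a, 1 - η ≤ a →
      (M.μ - M.β) * (M.ρ + M.hazard w) < M.hazard w * M.μ * (1 - M.β) * a - M.β * M.ρ)
    (hk : 0 < k) (hb : 0 ≤ b) (hbc : b < c) (hcτ : c ≤ τ)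
    (hS : ∀ s ∈ Ioo b c, 1 - E.stopping.cdf s = k) (ha : ∀ s ∈ Ioo b c, 1 - η ≤ E.act s) :
    M.disc b * k * (M.μ - M.β) - M.disc c * k * (M.μ - M.β)
      < ∫ s in b..c, M.marginA E s := by
  have hc : 0 ≤ c := hb.trans hbc.le
  have i1 := M.intervalIntegrable_marginA E hb hc
  have i2 := (intervalIntegrable_of_continuousOn M.continuousOn_decay hb hc).const_mul
    (k * (M.μ - M.β))
  have h := intervalIntegral.intervalIntegral_pos_of_pos_on (i1.sub i2) (fun s hs => ?_) hbc
  · rw [intervalIntegral.integral_sub i1 i2, intervalIntegral.integral_const_mul,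
      M.integral_decay hb hc] at h
    linarith
  · have hs0 : 0 ≤ s := hb.trans hs.1.le
    have h1 := hη s hs0 (hs.2.le.trans hcτ) _ (ha s hs)
    have h2 := mul_pos (mul_pos hk (M.disc_pos hs0)) (sub_pos.2 h1)
    rw [marginA, hS s hs]
    linarith

/-- The agent does not fake while the principal surely continues, if acceptance of type-1 news
occurs arbitrarily late in that period. -/
theorem IsEquilibrium.not_charges_of_cdf_const (hE : M.IsEquilibrium E) (hA2 : M.A2)
    {τ b c : ℝ} (hτ : M.hazard τ = M.φP) (hb : 0 ≤ b) (hcτ : c ≤ τ)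
    (hb1 : E.stopping.cdf b < 1) (hS : ∀ s ∈ Ico b c, E.stopping.cdf s = E.stopping.cdf b)
    (hfreq : ∀ x ∈ Ico b c, ∃ s ∈ Ioo x c, E.act s = 1) :
    ∀ t ∈ Ico b c, ¬ E.faking.Charges t := by
  obtain ⟨η, hη0, hη1, hη⟩ := exists_waiting_better hA2 hτ
  set k := 1 - E.stopping.cdf b with hk
  have hk0 : 0 < k := sub_pos.2 hb1
  set J : ℝ → ℝ := fun x => ∫ s in (0 : ℝ)..x, M.marginA E s with hJ
  set K : ℝ → ℝ := fun x => M.disc x * k * (M.μ - M.β) with hK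
  have hKpos : ∀ x, 0 ≤ x → 0 < K x := fun x hx =>
    mul_pos (mul_pos (M.disc_pos hx) hk0) (sub_pos.2 M.β_lt_μ)
  have hJc : ContinuousOn J (Ici 0) := continuousOn_integral_marginA M E
  have hKc : ContinuousOn K (Ici 0) := (M.disc_continuousOn.mul_const _).mul_const _
  have hu : ∀ t ∈ Ico b c, M.uA E t = M.β + J t + K t * E.act t := fun t ht => by
    rw [M.uA_eq E (hb.trans ht.1), hS t ht]
  have hS' : ∀ x ∈ Ico b c, ∀ y ≤ c, ∀ s ∈ Ioo x y, 1 - E.stopping.cdf s = k :=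
    fun x hx y hy s hs => by rw [hS s ⟨hx.1.trans hs.1.le, hs.2.trans_le hy⟩]
  -- Sure acceptance has to be shown on the whole interval first: otherwise the premium `K t * act
  -- t` could fall and upset the comparison of faking times.
  have hact : ∀ u ∈ Ico b c, E.act u = 1 := by
    intro u hu0
    by_contra hau
    set A := {s | s ∈ Ioo u c ∧ E.act s = 1} with hA
    obtain ⟨s₀, hs₀, has₀⟩ := hfreq u hu0
    have hAne : A.Nonempty := ⟨s₀, hs₀, has₀⟩
    have hAbdd : BddBelow A := ⟨u, fun s hs => hs.1.1.le⟩
    set r := sInf A with hr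
    have hur : u ≤ r := le_csInf hAne fun s hs => hs.1.1.le
    have hrc : r < c := (csInf_le hAbdd ⟨hs₀, has₀⟩).trans_lt hs₀.2
    have hu_nonneg : 0 ≤ u := hb.trans hu0.1
    have hr0 : 0 ≤ r := hu_nonneg.trans hur
    have hcl : r ∈ closure A := csInf_mem_closure hAne hAbdd
    -- A time without sure acceptance is charged, hence at least as good as every accepted time in
    -- `A`; letting those approach `r` gives the bound by continuity of `J + K`.
    have key : ∀ v, u ≤ v → v ≤ r → E.act v ≠ 1 → J r + K r ≤ J v + K v * E.act v := by
      intro v huv hvr hv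
      have hv0 := hu_nonneg.trans huv
      have hvI : v ∈ Ico b c := ⟨hu0.1.trans huv, hvr.trans_lt hrc⟩
      have hch := hE.actOptimal.charges_of_act_ne_one hv0 hv
      have hA0 : A ⊆ Ici 0 := fun s hs => hu_nonneg.trans hs.1.1.le
      have : (fun s => J s + K s) r ∈ closure (Iic (J v + K v * E.act v)) := by
        have hcw : ContinuousWithinAt (fun s => J s + K s) A r :=
          ((hJc.add hKc) r hr0).mono hA0
        refine hcw.mem_closure hcl fun s hs => ?_
        have hsI : s ∈ Ico b c := ⟨hu0.1.trans hs.1.1.le, hs.1.2⟩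
        have h1 := hE.uA_le_of_charges hch (hA0 hs)
        rw [hu s hsI, hu v hvI, hs.2, mul_one] at h1
        rw [mem_Iic]
        linarith
      rwa [closure_Iic, mem_Iic] at this
    rcases hur.eq_or_lt with hEq | hlt
    · have h1 := key u le_rfl hur hau
      rw [← hEq] at h1
      have h2 : E.act u < 1 := lt_of_le_of_ne (E.act_mem u).2 hau
      have h3 := mul_lt_mul_of_pos_left h2 (hKpos u hu_nonneg)
      linarith
    -- Before `r` no time is surely accepted, so `key` holds on all of `[u, r)` and forces `act`
    -- close to `1` near `r`. But then waiting until `r` is strictly profitable, contradicting `key`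
    -- at `v`.
    · have hne : ∀ v, u ≤ v → v < r → E.act v ≠ 1 := by
        intro v huv hvr hv
        rcases huv.eq_or_lt with h | h
        · exact hau (h ▸ hv)
        · exact absurd (csInf_le hAbdd (show v ∈ A from ⟨⟨h, hvr.trans hrc⟩, hv⟩)) (not_le.2 hvr)
      have hφc : ContinuousWithinAt (fun w => K r + J r - J w - (1 - η) * K w) (Ici 0) r :=
        ((continuousWithinAt_const.sub (hJc r hr0)).sub ((hKc r hr0).const_smul (1 - η)))
      have hφpos : 0 < K r + J r - J r - (1 - η) * K r := by
        have := mul_pos hη0 (hKpos r hr0)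
        linarith
      have hev := hφc.eventually_const_lt hφpos
      obtain ⟨ε, hε, hev⟩ := Metric.nhdsWithin_basis_ball.eventually_iff.1 hev
      set v := max u (r - ε / 2) with hv
      have hvr : v < r := max_lt hlt (by linarith)
      have huv : u ≤ v := le_max_left _ _
      have hv0 : 0 ≤ v := hu_nonneg.trans huv
      have hnear : ∀ w ∈ Ioo v r, 1 - η ≤ E.act w := by
        intro w hw
        have hw0 : 0 ≤ w := hv0.trans hw.1.le
        have hball : w ∈ Metric.ball r ε := by
          rw [Metric.mem_ball, Real.dist_eq, abs_lt]
          have := (le_max_right u (r - ε / 2)).trans_lt hw.1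
          constructor <;> linarith [hw.2]
        have h1 := hev ⟨hball, hw0⟩
        have h2 := key w (huv.trans hw.1.le) hw.2.le (hne w (huv.trans hw.1.le) hw.2)
        have h3 : (1 - η) * K w < E.act w * K w := by linarith
        exact (lt_of_mul_lt_mul_right h3 (hKpos w hw0).le).le
      have hvI : v ∈ Ico b c := ⟨hu0.1.trans huv, hvr.trans hrc⟩
      have h1 := waiting_gain hη hk0 hv0 hvr (hrc.le.trans hcτ) (hS' v hvI r hrc.le) hnear
      have h2 := integral_marginA_sub M E hv0 hr0
      have h3 := key v huv hvr.le (hne v huv hvr)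
      have h4 := mul_le_mul_of_nonneg_left (E.act_mem v).2 (hKpos v hv0).le
      simp only [hK, hJ] at h1 h2 h3 h4
      linarith
  -- With sure acceptance the payoff is `β + J + K`, strictly increasing on the interval, so faking
  -- halfway to `c` beats faking at `t`.
  intro t ht hch
  set t' := (t + c) / 2 with ht'
  have htt' : t < t' := by rw [ht']; linarith [ht.2]
  have ht'c : t' < c := by rw [ht']; linarith [ht.2]
  have ht0 : 0 ≤ t := hb.trans ht.1
  have ht'0 : 0 ≤ t' := ht0.trans htt'.le
  have ht'I : t' ∈ Ico b c := ⟨ht.1.trans htt'.le, ht'c⟩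
  have h1 := waiting_gain hη hk0 ht0 htt' (ht'c.le.trans hcτ) (hS' t ht t' ht'c.le)
    (fun s hs => by rw [hact s ⟨ht.1.trans hs.1.le, hs.2.trans ht'c⟩]; linarith)
  have h2 := integral_marginA_sub M E ht0 ht'0
  have h3 := hE.uA_le_of_charges hch ht'0
  rw [hu t ht, hu t' ht'I, hact t ht, hact t' ht'I] at h3
  simp only [hK, hJ] at h1 h2 h3
  linarith

/-- Once the principal has surely stopped, the timing of fakes is irrelevant. -/
theorem uA_eq_of_cdf_eq_one (M : SearchGame) (E : Profile) {c t : ℝ} (hc : 0 ≤ c) (hct : c ≤ t)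
    (h1 : E.stopping.cdf c = 1) : M.uA E t = M.β + ∫ s in (0 : ℝ)..c, M.marginA E s := by
  have hS : ∀ s, c ≤ s → E.stopping.cdf s = 1 := fun s hs =>
    le_antisymm (E.stopping.cdf_le_one s) (h1 ▸ E.stopping.cdf_mono hs)
  have h2 : ∫ s in c..t, M.marginA E s = 0 := by
    rw [intervalIntegral.integral_congr (g := fun _ => 0), intervalIntegral.integral_zero]
    intro s hs
    rw [uIcc_of_le hct] at hs
    simp only [marginA, hS s hs.1, sub_self, zero_mul]
  have h3 := integral_marginA_sub M E hc (hc.trans hct)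
  rw [M.uA_eq E (hc.trans hct), hS t hct]
  linarith

/-- The agent fakes before the principal has surely stopped. -/
theorem IsEquilibrium.not_charges_of_cdf_eq_one (hE : M.IsEquilibrium E) {c : ℝ}
    (hc : 0 < c) (hmax : IsMaxOn (M.uP E) (Ici 0) c) (h1 : E.stopping.cdf c = 1)
    (hlt : ∀ s < c, E.stopping.cdf s < 1) :
    (∀ t, c ≤ t → ¬ E.faking.Charges t) ∧ E.faking.never ≤ 0 := by
  have hh0 := M.hazard_pos le_rfl
  have hμβ := sub_pos.2 M.β_lt_μ
  -- The accepted time `s` is taken so close to `c` that the most the agent can earn by waiting, at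
  -- rate at most `hazard 0`, stays below the premium `μ - β` collected by faking at once.
  have hx : max 0 (c - (M.μ - M.β) / M.hazard 0) < c := max_lt hc (by
    have := div_pos hμβ hh0
    linarith)
  obtain ⟨s, hs, has⟩ := hE.actOptimal.exists_act_eq_one (le_max_left _ _) hx hmax
  have hs0 : 0 ≤ s := (le_max_left _ _).trans hs.1.le
  have hsc : (c - s) * M.hazard 0 < M.μ - M.β := by
    have := (le_max_right 0 _).trans_lt hs.1
    rw [← lt_div_iff₀ hh0]; linarith
  have hSs : 0 < 1 - E.stopping.cdf s := sub_pos.2 (hlt s hs.2)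
  have hds := M.disc_pos hs0
  have hbound : ∫ w in s..c, M.marginA E w
      ≤ ∫ _ in s..c, (1 - E.stopping.cdf s) * M.disc s * M.hazard 0 := by
    refine intervalIntegral.integral_mono_on hs.2.le (M.intervalIntegrable_marginA E hs0 hc.le)
      intervalIntegrable_const fun w hw => ?_
    have hw0 : 0 ≤ w := hs0.trans hw.1
    have hSw : 0 ≤ 1 - E.stopping.cdf w := sub_nonneg.2 (E.stopping.cdf_le_one w)
    have hdw := M.disc_pos hw0
    have hμ1 : M.μ * (1 - M.β) * E.act w ≤ 1 := by
      refine mul_le_one₀ (mul_le_one₀ M.μ_lt_one.le (sub_pos.2 M.β_lt_one).le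
        (by linarith [M.β_pos])) (E.act_mem w).1 (E.act_mem w).2
    have hb1 : M.hazard w * M.μ * (1 - M.β) * E.act w - M.β * M.ρ ≤ M.hazard 0 := by
      have h2 := mul_le_mul_of_nonneg_left hμ1 (M.hazard_nonneg hw0)
      have h3 := M.hazard_le le_rfl hw0
      have h4 := mul_pos M.β_pos M.ρ_pos
      linarith
    calc M.marginA E w ≤ (1 - E.stopping.cdf w) * (M.disc w * M.hazard 0) :=
          mul_le_mul_of_nonneg_left (mul_le_mul_of_nonneg_left hb1 hdw.le) hSw
      _ ≤ (1 - E.stopping.cdf s) * (M.disc s * M.hazard 0) := by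
          refine mul_le_mul (sub_le_sub_left (E.stopping.cdf_mono hw.1) _)
            (mul_le_mul_of_nonneg_right (M.disc_antitoneOn hs0 hw0 hw.1) hh0.le)
            (mul_pos hdw hh0).le hSs.le
      _ = _ := by ring
  rw [intervalIntegral.integral_const, smul_eq_mul] at hbound
  have hbetter : M.β + ∫ s in (0 : ℝ)..c, M.marginA E s < M.uA E s := by
    have h2 := integral_marginA_sub M E hs0 hc.le
    have h3 := mul_lt_mul_of_pos_left hsc (mul_pos hSs hds)
    rw [M.uA_eq E hs0, has]
    linarith
  constructor
  · intro t hct hch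
    have := hE.uA_le_of_charges hch hs0
    rw [uA_eq_of_cdf_eq_one M E hc.le hct h1] at this
    linarith
  · by_contra! hn
    have h2 := hE.faking_optimal.2 hn s hs0
    have h3 : M.uANever E = M.β + ∫ s in (0 : ℝ)..c, M.marginA E s := by
      refine tendsto_nhds_unique (M.tendsto_uA E) (tendsto_const_nhds.congr' ?_)
      filter_upwards [eventually_ge_atTop c] with t ht
      exact (uA_eq_of_cdf_eq_one M E hc.le ht h1).symm
    linarith

end SearchGame

/-! ### Distribution functions without atoms, and pointwise values of densities. -/

namespace TimeStrategy

variable (F : TimeStrategy)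

theorem never_nonneg : 0 ≤ F.never := by
  rw [F.never_eq]; linarith [F.law_real_univ_le_one]

theorem cdf_eq_of_disjoint_support {s t : ℝ} (h : s ≤ t)
    (hd : ∀ x ∈ Ioc s t, x ∉ F.law.support) : F.cdf t = F.cdf s :=
  F.cdf_eq_of_law_eq_zero h (measure_mono_null hd Measure.measure_compl_support)

theorem cdf_lt_of_mem_support {s t : ℝ} (ht : t ∈ F.law.support) (h : s < t) :
    F.cdf s < F.law.real univ :=
  ((F.cdf_lt_iff (by linarith : s ≤ t + 1)).2
    ((Measure.mem_support_iff_forall t).1 ht _ (Ioc_mem_nhds h (by linarith))).ne').trans_le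
    (F.cdf_le _)

theorem cdf_eq_of_support_subset {c : ℝ} (h : ∀ x ∈ F.law.support, x ≤ c) :
    F.cdf c = F.law.real univ := by
  rw [F.cdf_eq]
  refine measureReal_congr ?_
  filter_upwards [Measure.support_mem_ae (μ := F.law)] with x hx
  exact propext ⟨fun _ => mem_univ x, fun _ => h x hx⟩

theorem cdf_eq_integral (h : ∀ t, F.atom t = 0) (t : ℝ) :
    F.cdf t = ∫ s in (0 : ℝ)..t, F.density s := by
  have : ∀ s, (Iic t).indicator F.atom s = 0 := fun s => by
    by_cases hs : s ∈ Iic t <;> simp [hs, h s]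
  rw [cdf, tsum_congr this, tsum_zero, add_zero]

theorem intervalIntegrable_density (s t : ℝ) : IntervalIntegrable F.density volume s t :=
  F.density_integrable.intervalIntegrable

theorem continuous_cdf (h : ∀ t, F.atom t = 0) : Continuous F.cdf := by
  rw [show F.cdf = fun t => ∫ s in (0 : ℝ)..t, F.density s from funext (F.cdf_eq_integral h)]
  exact intervalIntegral.continuous_primitive F.intervalIntegrable_density 0

/-- If the density agrees almost everywhere to the right of `t` with a
continuous function, then it agrees with that function at `t`. -/
theorem density_eq_of_ae_eq {φ : ℝ → ℝ} (hφ : ContinuousOn φ (Ici 0))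
    {t c : ℝ} (ht : 0 ≤ t) (htc : t < c) (hae : ∀ᵐ s, s ∈ Ioo t c → F.density s = φ s) :
    F.density t = φ t := by
  -- An almost-everywhere identity says nothing at a single point; the convention that the density
  -- is the right derivative of the absolutely continuous part supplies the value.
  refine F.density_eq_deriv t ht _ ?_
  have hsub : Ici t ⊆ Ici 0 := Ici_subset_Ici.2 ht
  have hc : ContinuousOn φ (Ici t) := hφ.mono hsub
  have h1 : HasDerivWithinAt (fun u => ∫ x in t..u, φ x) (φ t) (Ici t) t :=
    intervalIntegral.integral_hasDerivWithinAt_right (t := Ioi t) IntervalIntegrable.refl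
      ((hc.mono Ioi_subset_Ici_self).stronglyMeasurableAtFilter_nhdsWithin measurableSet_Ioi t)
      ((hc t self_mem_Ici).mono Ioi_subset_Ici_self)
  have h2 := h1.const_add (∫ s in (0 : ℝ)..t, F.density s)
  have hpt : ∀ x, t ≤ x → x < c → ∫ s in (0 : ℝ)..x, F.density s
      = (∫ s in (0 : ℝ)..t, F.density s) + ∫ s in t..x, φ s := by
    intro x hx hxc
    rw [← intervalIntegral.integral_add_adjacent_intervals (F.intervalIntegrable_density 0 t)
      (F.intervalIntegrable_density t x)]
    congr 1
    refine intervalIntegral.integral_congr_ae ?_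
    filter_upwards [hae] with s hs hsx
    rw [uIoc_of_le hx] at hsx
    exact hs ⟨hsx.1, hsx.2.trans_lt hxc⟩
  refine h2.congr_of_eventuallyEq ?_ (hpt t le_rfl htc)
  filter_upwards [self_mem_nhdsWithin, mem_nhdsWithin_of_mem_nhds (Iio_mem_nhds htc)] with x hx hxc
  exact hpt x hx hxc

end TimeStrategy

/-! ### Indifference conditions and the structure of equilibrium. -/

namespace SearchGame

variable {M : SearchGame} {E : Profile}

/-- The hazard rate of fake news that makes the principal indifferent. -/
noncomputable def indifferenceRate (M : SearchGame) (t : ℝ) : ℝ :=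
  (M.μ * (1 - M.θ) * M.hazard t - M.ρ * M.θ) / (M.θ - M.μ)

/-- The posterior after type-1 news that makes the principal indifferent. -/
noncomputable def indifferencePosterior (M : SearchGame) (t : ℝ) : ℝ :=
  M.θ + (M.θ - M.μ) * (M.ρ * M.θ / (M.hazard t * M.μ * (1 - M.μ) - M.ρ * M.θ))

theorem indifferenceRate_eq (M : SearchGame) (t : ℝ) :
    M.indifferenceRate t = M.μ * (1 - M.θ) * (M.hazard t - M.φP) / (M.θ - M.μ) := by
  rw [indifferenceRate, ← M.φP_mul]; ring

theorem hazard_denominator_pos {t : ℝ} (h : M.φP ≤ M.hazard t) :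
    0 < M.hazard t * M.μ * (1 - M.μ) - M.ρ * M.θ := by
  have h1 := M.μ_lt_θ
  have h2 := M.φP_pos
  have h3 := mul_pos M.μ_pos (h2.trans_le h)
  have h4 := mul_pos h3 (sub_pos.2 h1)
  have h5 := mul_le_mul_of_nonneg_left h (mul_pos M.μ_pos (sub_pos.2 M.θ_lt_one)).le
  rw [M.φP_mul] at h5
  linarith

/-- At the first-best duration the indifference rate of fakes is zero, so type-1 news is fully
credible there. -/
theorem indifferencePosterior_of_hazard_eq {τ : ℝ} (hτ : M.hazard τ = M.φP) :
    M.indifferencePosterior τ = 1 := by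
  have hd := hazard_denominator_pos hτ.ge
  have h1 := M.φP_mul
  rw [← hτ] at h1
  rw [indifferencePosterior, ← mul_div_assoc, ← eq_sub_iff_add_eq', div_eq_iff hd.ne']
  linear_combination -(1 - M.μ) * h1

theorem posterior_of_indifferenceRate (F : TimeStrategy) {t : ℝ} (ht : 0 ≤ t)
    (h : M.φP ≤ M.hazard t) (ha : F.atom t = 0)
    (hf : F.density t = M.indifferenceRate t * M.unfaked F t / M.σ) :
    M.posterior F 1 t = M.indifferencePosterior t := by
  have hσ := M.σ_pos
  have hL := M.unfaked_pos F t
  have hG := M.one_sub_G_pos ht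
  have hθμ := sub_pos.2 M.μ_lt_θ
  have hd := hazard_denominator_pos h
  have hpos := M.newsDensity_one_pos F ht
  have e1 : M.σ * F.density t = M.indifferenceRate t * M.unfaked F t := by
    rw [hf]; field_simp
  have e2 : (M.θ - M.μ) * M.indifferenceRate t = M.μ * (1 - M.θ) * M.hazard t - M.ρ * M.θ := by
    rw [indifferenceRate, mul_div_cancel₀ _ hθμ.ne']
  have h1 := M.newsDensity_mul_posterior_sub F ht ha
  rw [gain, M.g_eq ht, e1] at h1
  have h2 : (M.hazard t * M.μ * (1 - M.μ) - M.ρ * M.θ) * (M.posterior F 1 t - M.θ)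
      = (M.θ - M.μ) * (M.ρ * M.θ) := by
    have hLG := (mul_pos hL hG).ne'
    refine mul_left_cancel₀ hLG ?_
    linear_combination (M.θ - M.μ) * h1 - (M.unfaked F t * (1 - M.G t))
      * ((M.posterior F 1 t - M.θ) + (M.θ - M.μ)) * e2
  rw [indifferencePosterior, ← mul_div_assoc, ← sub_eq_iff_eq_add', eq_div_iff hd.ne']
  linear_combination h2

theorem continuousOn_indifferencePosterior {τ : ℝ} (hτ : M.hazard τ = M.φP) :
    ContinuousOn M.indifferencePosterior (Icc 0 τ) := by
  have hh : ContinuousOn M.hazard (Icc 0 τ) := M.hazard_continuousOn.mono fun _ h => h.1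
  refine continuousOn_const.add (continuousOn_const.mul (continuousOn_const.div
    (((hh.mul_const _).mul_const _).sub continuousOn_const) fun t ht => ?_))
  exact (hazard_denominator_pos (hτ ▸ M.hazard_le ht.1 ht.2)).ne'

theorem strictMonoOn_indifferencePosterior {τ : ℝ} (hτ : M.hazard τ = M.φP) :
    StrictMonoOn M.indifferencePosterior (Icc 0 τ) := by
  intro s hs t ht hst
  have hd := hazard_denominator_pos (hτ ▸ M.hazard_le ht.1 ht.2 : M.φP ≤ M.hazard t)
  have h1 := mul_lt_mul_of_pos_right (M.hazard_lt hs.1 hst)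
    (mul_pos M.μ_pos (sub_pos.2 M.μ_lt_one))
  refine add_lt_add_right (mul_lt_mul_of_pos_left (div_lt_div_of_pos_left
    (mul_pos M.ρ_pos M.θ_pos) hd ?_) (sub_pos.2 M.μ_lt_θ)) _
  linarith

/-- The agent's faking strategy has no atoms. -/
theorem IsEquilibrium.faking_atom_eq_zero (hE : M.IsEquilibrium E) {m τ : ℝ}
    (hmax : ∀ t ∈ Icc m τ, IsMaxOn (M.uP E) (Ici 0) t)
    (hlt : ∀ s < τ, E.stopping.cdf s < 1)
    (hF0 : ∀ t ∈ Ico 0 m, ¬ E.faking.Charges t) (hF1 : ∀ t, τ ≤ t → ¬ E.faking.Charges t) (t : ℝ) :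
    E.faking.atom t = 0 := by
  by_contra hne
  have hpos : 0 < E.faking.atom t := lt_of_le_of_ne (E.faking.atom_nonneg t) (Ne.symm hne)
  have hch : E.faking.Charges t := Or.inr hpos
  have ht0 := hch.nonneg
  have htm : m ≤ t := not_lt.1 fun h => hF0 t ⟨ht0, h⟩ hch
  have htτ : t < τ := not_le.1 fun h => hF1 t h hch
  have hact : E.act t = 0 := hE.act_eq_zero t ht0 (by
    rw [M.posterior_of_atom_pos _ ht0 hpos]; exact M.μ_lt_θ)
  -- This is the payoff that faking right after `t` would yield under sure acceptance. Its right
  -- limit exceeds `uA t` because news at the atom is rejected; right-continuity of the stopping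
  -- distribution suffices.
  have hlim : Tendsto (fun s => M.β + (∫ x in (0 : ℝ)..s, M.marginA E x)
      + M.disc s * (1 - E.stopping.cdf s) * (M.μ - M.β)) (𝓝[>] t)
      (𝓝 (M.β + (∫ x in (0 : ℝ)..t, M.marginA E x)
      + M.disc t * (1 - E.stopping.cdf t) * (M.μ - M.β))) := by
    have hsub : Ioi t ⊆ Ici 0 := fun s hs => ht0.trans (le_of_lt hs)
    have h1 := ((continuousOn_integral_marginA M E) t ht0).mono hsub
    have h2 := (M.disc_continuousOn t ht0).mono hsub
    exact (h1.tendsto.const_add _).add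
      ((h2.tendsto.mul ((E.stopping.tendsto_cdf_right t).const_sub 1)).mul_const _)
  have hgt : M.uA E t < M.β + (∫ x in (0 : ℝ)..t, M.marginA E x)
      + M.disc t * (1 - E.stopping.cdf t) * (M.μ - M.β) := by
    rw [M.uA_eq E ht0, hact]
    have := mul_pos (mul_pos (M.disc_pos ht0) (sub_pos.2 (hlt t htτ))) (sub_pos.2 M.β_lt_μ)
    linarith
  have hev := hlim.eventually_const_lt hgt
  obtain ⟨c, hc, hev⟩ := (mem_nhdsGT_iff_exists_Ioo_subset).1
    (hev.and (Ioo_mem_nhdsGT htτ))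
  have hcI : min c τ ∈ Icc m τ := ⟨le_min (htm.trans (le_of_lt hc)) (htm.trans htτ.le),
    min_le_right _ _⟩
  obtain ⟨s, hs, has⟩ := hE.actOptimal.exists_act_eq_one ht0 (lt_min hc htτ) (hmax _ hcI)
  have h1 := (hev ⟨hs.1, hs.2.trans_le (min_le_left _ _)⟩).1
  have hs0 : 0 ≤ s := ht0.trans hs.1.le
  have h2 := hE.uA_le_of_charges hch hs0
  rw [M.uA_eq E hs0, has, mul_one] at h2
  linarith

/-- Where the principal is indifferent, fake news arrives at the indifference rate. -/
theorem ActOptimal.ae_density_eq (hE : M.ActOptimal E) {m τ : ℝ} (hm : 0 < m) (hmτ : m < τ)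
    (hmax : ∀ t ∈ Icc m τ, IsMaxOn (M.uP E) (Ici 0) t) :
    ∀ᵐ s, s ∈ Ioo m τ → E.faking.density s
      = M.indifferenceRate s * M.unfaked E.faking s / M.σ := by
  have hi := M.intervalIntegrable_marginP E hm.le (hm.le.trans hmτ.le)
  filter_upwards [hi.ae_hasDerivAt_integral, E.faking.ae_atom_eq_zero] with s hs h0 hsI
  have hs0 : 0 ≤ s := hm.le.trans hsI.1.le
  have h1 := hs (by rw [uIcc_of_le hmτ.le]; exact Ioo_subset_Icc_self hsI) m left_mem_uIcc
  -- All points of `[m, τ]` maximize `uP`, so its increments vanish and so does the margin, by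
  -- Lebesgue differentiation.
  have h2 : (fun x => ∫ t in m..x, M.marginP E t) =ᶠ[𝓝 s] fun _ => (0 : ℝ) := by
    filter_upwards [Ioo_mem_nhds hsI.1 hsI.2] with x hx
    have hx0 : 0 ≤ x := hm.le.trans hx.1.le
    rw [← hE.uP_sub hm.le hx0]
    have h3 := hmax m (left_mem_Icc.2 hmτ.le) (mem_Ici.2 hx0)
    have h4 := hmax x (Ioo_subset_Icc_self hx) (mem_Ici.2 hm.le)
    exact sub_eq_zero.2 (le_antisymm h3 h4)
  have h3 : M.marginP E s = 0 := (h1.congr_of_eventuallyEq h2.symm).unique (hasDerivAt_const s 0)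
  rw [marginP_eq] at h3
  have h4 := (mul_eq_zero.1 h3).resolve_left (Real.exp_pos _).ne'
  have hG := M.one_sub_G_pos hs0
  have hL := M.unfaked_pos E.faking s
  -- Indifference needs a strictly positive value of accepted news to offset the cost of delay; this
  -- excludes mixing and forces sure acceptance.
  have hag : 0 < E.act s * M.gain E.faking s := by
    have := mul_pos (mul_pos M.ρ_pos M.θ_pos) (mul_pos hG hL)
    linarith
  have hg : 0 < M.gain E.faking s := pos_of_mul_pos_right hag (E.act_mem s).1
  have hact : E.act s = 1 := by
    by_contra hne
    exact absurd (M.gain_nonpos_of_posterior_le E.faking hs0 h0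
      (hE.posterior_le_of_act_ne_one hs0 hne)) (not_le.2 hg)
  rw [hact, one_mul, gain, M.g_eq hs0] at h4
  have hθμ := sub_pos.2 M.μ_lt_θ
  have hσ := M.σ_pos
  rw [indifferenceRate, eq_div_iff hσ.ne', div_mul_eq_mul_div, eq_div_iff hθμ.ne']
  refine mul_left_cancel₀ hG.ne' ?_
  linear_combination -h4

/-- In an equilibrium with beneficial search the stopping strategy is supported on an interval
that ends at the first-best duration, and faking is confined to it. -/
theorem IsEquilibrium.exists_support_eq_Icc (hE : M.IsEquilibrium E) (hA2 : M.A2)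
    (hB : M.BeneficialSearch E) {τ : ℝ} (hτ0 : 0 < τ) (hτ : M.hazard τ = M.φP) :
    ∃ m, 0 < m ∧ m < τ ∧ E.stopping.law.support = Icc m τ ∧
      (∀ t ∈ Icc m τ, IsMaxOn (M.uP E) (Ici 0) t) ∧ (∀ s < τ, E.stopping.cdf s < 1) ∧
      (∀ t ∈ Ico 0 m, ¬ E.faking.Charges t) ∧ (∀ t, τ ≤ t → ¬ E.faking.Charges t) ∧
      E.faking.never = 0 := by
  set T := E.stopping.law.support with hT
  have hA := hE.actOptimal
  have huniv : E.stopping.law.real univ = 1 := by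
    have h1 := hE.stopping_never hτ0 hτ
    rw [E.stopping.never_eq] at h1
    linarith
  have hne : T.Nonempty := by
    refine Measure.nonempty_support fun h => ?_
    rw [h] at huniv
    simp at huniv
  have hclosed : IsClosed T := Measure.isClosed_support
  have hmaxT : ∀ t ∈ T, IsMaxOn (M.uP E) (Ici 0) t := fun t ht => hE.isMaxOn_uP ht
  have hTpos : ∀ t ∈ T, 0 < t := fun t ht => by
    refine lt_of_le_of_ne (nonneg_of_mem_support _ ht) ?_
    rintro rfl
    obtain ⟨x, hx, hgt⟩ := hE.exists_uP_gt hB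
    have := hmaxT _ ht (mem_Ici.2 hx)
    rw [mem_ofPred_eq, hA.uP_zero] at this
    linarith
  have hTle : ∀ t ∈ T, t ≤ τ := fun t ht => by
    by_contra! h
    exact absurd (hA.uP_lt_of_hazard_le hτ0 hτ le_rfl h) (not_lt.2 (hmaxT t ht (mem_Ici.2 hτ0.le)))
  have hbelow : BddBelow T := ⟨0, fun t ht => (hTpos t ht).le⟩
  have habove : BddAbove T := ⟨τ, hTle⟩
  set m := sInf T with hm
  set c := sSup T with hc
  have hmT : m ∈ T := hclosed.csInf_mem hne hbelow
  have hcT : c ∈ T := hclosed.csSup_mem hne habove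
  have hm0 := hTpos m hmT
  have hc0 := hTpos c hcT
  have hltc : ∀ s < c, E.stopping.cdf s < 1 := fun s hs =>
    huniv ▸ E.stopping.cdf_lt_of_mem_support hcT hs
  have hcdf1 : E.stopping.cdf c = 1 := by
    rw [E.stopping.cdf_eq_of_support_subset fun x hx => le_csSup habove hx, huniv]
  obtain ⟨hF1, hnev⟩ := hE.not_charges_of_cdf_eq_one hc0 (hmaxT c hcT) hcdf1 hltc
  -- If stopping ended before `τ`, search on `[c, τ]` would be free of fakes and strictly
  -- profitable.
  have hcτ : c = τ := by
    refine le_antisymm (hTle c hcT) (not_lt.1 fun h => ?_)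
    have := hA.uP_lt_of_not_charges hτ hc0.le h le_rfl fun s hs => hF1 s hs.1.le
    exact absurd this (not_lt.2 (hmaxT c hcT (mem_Ici.2 hτ0.le)))
  have hgap : ∀ b e, 0 ≤ b → b < e → e ∈ T → (∀ x ∈ Ioo b e, x ∉ T) →
      ∀ t ∈ Ico b e, ¬ E.faking.Charges t := by
    intro b e hb hbe he hd
    refine hE.not_charges_of_cdf_const hA2 hτ hb (hTle e he)
      (hltc b (hbe.trans_le (le_csSup habove he))) (fun s hs => ?_) fun x hx =>
        hA.exists_act_eq_one (hb.trans hx.1) hx.2 (hmaxT e he)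
    exact E.stopping.cdf_eq_of_disjoint_support hs.1 fun x hx => hd x ⟨hx.1, hx.2.trans_lt hs.2⟩
  have hF0 : ∀ t ∈ Ico 0 m, ¬ E.faking.Charges t :=
    hgap 0 m le_rfl hm0 hmT fun x hx hxT => absurd (csInf_le hbelow hxT) (not_le.2 hx.2)
  -- A point missing from `T` lies in a maximal gap `(b, e)` with both ends in `T`, as `T` is
  -- closed. No faking there makes `uP` strictly larger at `e` than at `b`, although `b` is a
  -- maximizer.
  have hIcc : T = Icc m τ := by
    refine Subset.antisymm (fun x hx => ⟨csInf_le hbelow hx, hTle x hx⟩) fun x hx => ?_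
    by_contra hxT
    have hl : BddAbove (T ∩ Iic x) := ⟨x, fun y hy => hy.2⟩
    have hr : BddBelow (T ∩ Ici x) := ⟨x, fun y hy => hy.2⟩
    have hbm := (hclosed.inter isClosed_Iic).csSup_mem ⟨m, hmT, hx.1⟩ hl
    have hem := (hclosed.inter isClosed_Ici).csInf_mem ⟨c, hcT, hcτ ▸ hx.2⟩ hr
    set b := sSup (T ∩ Iic x)
    set e := sInf (T ∩ Ici x)
    have hbx : b < x := lt_of_le_of_ne hbm.2 fun h => hxT (h ▸ hbm.1)
    have hxe : x < e := lt_of_le_of_ne hem.2 fun h => hxT (h ▸ hem.1)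
    have hb0 := (hTpos b hbm.1).le
    have hun := hgap b e hb0 (hbx.trans hxe) hem.1 fun y hy hyT => by
      rcases le_total y x with h | h
      · exact absurd (le_csSup hl ⟨hyT, h⟩) (not_le.2 hy.1)
      · exact absurd (csInf_le hr ⟨hyT, h⟩) (not_le.2 hy.2)
    have := hA.uP_lt_of_not_charges hτ hb0 (hbx.trans hxe) (hTle e hem.1)
      fun s hs => hun s ⟨hs.1.le, hs.2⟩
    exact absurd this (not_lt.2 (hmaxT b hbm.1 (mem_Ici.2 (hTpos e hem.1).le)))
  have hmτ : m < τ := by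
    -- If `m = τ`, no time is charged and the faking law is null; then all mass sits on never
    -- faking, contradicting `hnev`.
    refine lt_of_le_of_ne (hTle m hmT) fun h => ?_
    have h0 : E.faking.law univ = 0 := E.faking.law_eq_zero MeasurableSet.univ fun t _ hch =>
      (lt_or_ge t m).elim (fun h1 => hF0 t ⟨hch.nonneg, h1⟩ hch)
        fun h1 => hF1 t (by rw [hcτ, ← h]; exact h1) hch
    rw [E.faking.never_eq, measureReal_def, h0, ENNReal.toReal_zero] at hnev
    linarith
  refine ⟨m, hm0, hmτ, hIcc, fun t ht => hmaxT t (hIcc ▸ ht), hcτ ▸ hltc, hF0, hcτ ▸ hF1, ?_⟩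
  exact le_antisymm hnev E.faking.never_nonneg

end SearchGame

/-! ### Support of faking and the shape of beliefs. -/

theorem TimeStrategy.support_eq_Icc (F : TimeStrategy) {m τ : ℝ} (hmτ : m < τ)
    (ha : ∀ t, F.atom t = 0) (hpos : ∀ t ∈ Ioo m τ, 0 < F.density t)
    (hch : ∀ t, F.Charges t → t ∈ Icc m τ) : F.law.support = Icc m τ := by
  refine Subset.antisymm (fun t ht => ?_) fun t ht => ?_
  · constructor
    · by_contra! h
      obtain ⟨s, hs, hc⟩ := F.exists_charges_near ht (sub_pos.2 h)
      linarith [hs.2, (hch s hc).1]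
    · by_contra! h
      obtain ⟨s, hs, hc⟩ := F.exists_charges_near ht (sub_pos.2 h)
      linarith [hs.1, (hch s hc).2]
  · rw [← F.setOf_support_eq]
    intro ε hε
    have hxy : max m (t - ε) < min τ (t + ε) :=
      max_lt (lt_min hmτ (by linarith [ht.1])) (lt_min (by linarith [ht.2]) (by linarith))
    have h1 := intervalIntegral.intervalIntegral_pos_of_pos_on
      (F.intervalIntegrable_density (max m (t - ε)) (min τ (t + ε)))
      (fun s hs => hpos s ⟨(le_max_left _ _).trans_lt hs.1, hs.2.trans_le (min_le_left _ _)⟩) hxy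
    rw [← intervalIntegral.integral_interval_sub_left (F.intervalIntegrable_density 0 _)
      (F.intervalIntegrable_density 0 _), ← F.cdf_eq_integral ha, ← F.cdf_eq_integral ha] at h1
    have h2 := F.cdf_mono (le_max_right m (t - ε))
    have h3 := F.cdf_mono (min_le_right τ (t + ε))
    linarith

theorem corollary1 (M : SearchGame) (hA1 : M.A1) (hA2 : M.A2) (E : Profile)
    (hE : M.IsEquilibrium E) (hB : M.BeneficialSearch E) :
    ∃ τM τP : ℝ, 0 < τM ∧ τM < τP ∧
      M.IsFirstBestDuration τP ∧
      E.faking.HasSupport (Icc τM τP) ∧ E.stopping.HasSupport (Icc τM τP) ∧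
      -- the posterior after type-1 news
      (∀ t, 0 ≤ t → t < τM → M.posterior E.faking 1 t = 1) ∧
      (∀ t ∈ Icc τM τP, 0 < M.hazard t * M.μ * (1 - M.μ) - M.ρ * M.θ ∧
        M.posterior E.faking 1 t =
          M.θ + (M.θ - M.μ) * (M.ρ * M.θ / (M.hazard t * M.μ * (1 - M.μ) - M.ρ * M.θ))) ∧
      (∀ t, τP ≤ t → M.posterior E.faking 1 t = 1) ∧
      -- downward jump at the soft deadline
      Tendsto (M.posterior E.faking 1) (𝓝[<] τM) (𝓝 1) ∧
      Tendsto (M.posterior E.faking 1) (𝓝[>] τM) (𝓝 (M.posterior E.faking 1 τM)) ∧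
      M.posterior E.faking 1 τM < 1 ∧
      -- monotonicity, continuity at the hard deadline, lower bound
      StrictMonoOn (M.posterior E.faking 1) (Ico τM τP) ∧
      ContinuousAt (M.posterior E.faking 1) τP ∧
      (∃ ε, 0 < ε ∧ ∀ t, 0 ≤ t → M.θ + ε ≤ M.posterior E.faking 1 t) ∧
      -- type-0 news has positive density and reveals that the risky payoff is zero
      (∀ t, 0 ≤ t → 0 < ∑ ω, M.newsDensity E.faking ω 0 t ∧ M.posterior E.faking 0 t = 0) := by
  obtain ⟨τ, hτ0, hτ⟩ := M.exists_hazard_eq hA1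
  obtain ⟨m, hm0, hmτ, hsupp, hmax, hlt, hF0, hF1, hnev⟩ :=
    hE.exists_support_eq_Icc hA2 hB hτ0 hτ
  have hatom := hE.faking_atom_eq_zero hmax hlt hF0 hF1
  have hae := hE.actOptimal.ae_density_eq hm0 hmτ hmax
  have hh : ∀ t ∈ Icc m τ, M.φP ≤ M.hazard t := fun t ht =>
    hτ ▸ M.hazard_le (hm0.le.trans ht.1) ht.2
  have hcont : ContinuousOn
      (fun s => M.indifferenceRate s * M.unfaked E.faking s / M.σ) (Ici 0) := by
    have h1 : ContinuousOn M.indifferenceRate (Ici 0) :=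
      ((continuousOn_const.mul M.hazard_continuousOn).sub continuousOn_const).div_const _
    have h2 : Continuous (M.unfaked E.faking) :=
      continuous_const.sub (continuous_const.mul (E.faking.continuous_cdf hatom))
    exact (h1.mul h2.continuousOn).div_const _
  have hdens : ∀ t ∈ Ico m τ, E.faking.density t
      = M.indifferenceRate t * M.unfaked E.faking t / M.σ := fun t ht => by
    refine E.faking.density_eq_of_ae_eq hcont (hm0.le.trans ht.1) ht.2 ?_
    filter_upwards [hae] with s hs hsI using hs ⟨ht.1.trans_lt hsI.1, hsI.2⟩
  have hpost0 : ∀ t, 0 ≤ t → t < m → M.posterior E.faking 1 t = 1 := fun t ht htm =>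
    M.posterior_eq_one_of_not_charges _ ht (hF0 t ⟨ht, htm⟩)
  have hpost1 : ∀ t, τ ≤ t → M.posterior E.faking 1 t = 1 := fun t ht =>
    M.posterior_eq_one_of_not_charges _ (hτ0.le.trans ht) (hF1 t ht)
  -- The right derivative pins the density down only on `[m, τ)`. At `τ` nothing is charged, so the
  -- posterior is `1`, which is also the value of the formula.
  have hpost : ∀ t ∈ Icc m τ, M.posterior E.faking 1 t = M.indifferencePosterior t := by
    intro t ht
    rcases ht.2.eq_or_lt with h | h
    · rw [hpost1 t h.ge, h, SearchGame.indifferencePosterior_of_hazard_eq hτ]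
    · exact SearchGame.posterior_of_indifferenceRate _ (hm0.le.trans ht.1) (hh t ht) (hatom t)
        (hdens t ⟨ht.1, h⟩)
  have hsub : Icc m τ ⊆ Icc 0 τ := Icc_subset_Icc_left hm0.le
  have hBc := (SearchGame.continuousOn_indifferencePosterior hτ).mono hsub
  have hBm := (SearchGame.strictMonoOn_indifferencePosterior hτ).mono hsub
  have hmI : m ∈ Icc m τ := left_mem_Icc.2 hmτ.le
  have hτI : τ ∈ Icc m τ := right_mem_Icc.2 hmτ.le
  have hlt1 : M.indifferencePosterior m < 1 := by
    rw [← SearchGame.indifferencePosterior_of_hazard_eq hτ]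
    exact hBm hmI hτI hmτ
  have hθlt : M.θ < M.indifferencePosterior m :=
    lt_add_of_pos_right _ (mul_pos (sub_pos.2 M.μ_lt_θ) (div_pos (mul_pos M.ρ_pos M.θ_pos)
      (SearchGame.hazard_denominator_pos (hh m hmI))))
  refine ⟨m, τ, hm0, hmτ, M.isFirstBestDuration_of_hazard_eq hτ0 hτ, ⟨hnev, ?_⟩,
    ⟨hE.stopping_never hτ0 hτ, ?_⟩, hpost0,
    fun t ht => ⟨SearchGame.hazard_denominator_pos (hh t ht), hpost t ht⟩, hpost1,
    ?_, ?_, ?_, ?_, ?_, ⟨M.indifferencePosterior m - M.θ, sub_pos.2 hθlt, ?_⟩, ?_⟩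
  · rw [E.faking.setOf_support_eq]
    refine E.faking.support_eq_Icc hmτ hatom (fun t ht => ?_) fun t ht => ⟨?_, ?_⟩
    · have h1 := M.hazard_lt (hm0.le.trans ht.1.le) ht.2
      rw [hτ] at h1
      rw [hdens t ⟨ht.1.le, ht.2⟩, M.indifferenceRate_eq]
      exact div_pos (mul_pos (div_pos (mul_pos (mul_pos M.μ_pos (sub_pos.2 M.θ_lt_one))
        (sub_pos.2 h1)) (sub_pos.2 M.μ_lt_θ)) (M.unfaked_pos _ t)) M.σ_pos
    · exact not_lt.1 fun h => hF0 t ⟨ht.nonneg, h⟩ ht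
    · exact not_lt.1 fun h => hF1 t h.le ht
  · rw [E.stopping.setOf_support_eq, hsupp]
  · refine tendsto_const_nhds.congr' ?_
    filter_upwards [Ioo_mem_nhdsLT hm0] with t ht
    exact (hpost0 t ht.1.le ht.2).symm
  · rw [hpost m hmI]
    have h1 : Tendsto M.indifferencePosterior (𝓝[>] m) (𝓝 (M.indifferencePosterior m)) :=
      (hBc m hmI).mono_of_mem_nhdsWithin (Icc_mem_nhdsGT hmτ)
    refine h1.congr' ?_
    filter_upwards [Ioo_mem_nhdsGT hmτ] with t ht
    exact (hpost t (Ioo_subset_Icc_self ht)).symm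
  · rw [hpost m hmI]; exact hlt1
  · intro s hs t ht hst
    rw [hpost s (Ico_subset_Icc_self hs), hpost t (Ico_subset_Icc_self ht)]
    exact hBm (Ico_subset_Icc_self hs) (Ico_subset_Icc_self ht) hst
  · rw [continuousAt_iff_continuous_left_right]
    constructor
    · have h1 : ContinuousWithinAt M.indifferencePosterior (Iic τ) τ :=
        (hBc τ hτI).mono_of_mem_nhdsWithin (Icc_mem_nhdsLE hmτ)
      refine h1.congr_of_eventuallyEq ?_ (hpost τ hτI)
      filter_upwards [Icc_mem_nhdsLE hmτ] with t ht using hpost t ht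
    · exact continuousWithinAt_const.congr (fun t ht => hpost1 t ht) (hpost1 τ le_rfl)
  -- The minimum of the posterior over all times is attained at `m`, so `ε` is its excess over `θ`
  -- there.
  · intro t ht
    rw [add_sub_cancel]
    rcases lt_or_ge t m with h | h
    · rw [hpost0 t ht h]; exact hlt1.le
    · rcases lt_or_ge t τ with h' | h'
      · rw [hpost t ⟨h, h'.le⟩]; exact hBm.monotoneOn hmI ⟨h, h'.le⟩ h
      · rw [hpost1 t h']; exact hlt1.le
  · intro t ht
    constructor
    · rw [M.sum_newsDensity_zero]
      exact mul_pos (mul_pos (sub_pos.2 M.μ_lt_one) (M.g_pos ht)) (M.unfaked_pos _ t)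
    -- Type-0 news has no atoms, so the posterior is the ratio of densities, whose numerator
    -- vanishes: in state `1` neither real nor fake news is of type `0`.
    · simp [SearchGame.posterior, SearchGame.newsAtom, SearchGame.newsDensity]
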